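/- Let $X_1,X_2,\dots$ be independent real random variables with a common probability density $\phi$ in the Schwartz class. For $p,q\in\mathbb N=\{1,2,\dots\}$ put $S_p=X_1+\dots+X_p$ and $T_{p+q}=\max(0,S_1,\dots,S_{p+q})$. For $j\ge1$ and $x_1,\dots,x_j\in\mathbb C$ put $$\Phi_j[z^m](x_1,\dots,x_j)=\sum_{\substack{l_1,\dots,l_j\ge1\\ l_1+\dots+l_j=m}}\frac{x_1^{l_1}}{l_1}\cdots\frac{x_j^{l_j}}{l_j}\qquad(m\ge1)$$ (so that $\Phi_j[z^m]=0$ for $m<j$), and extend this linearly to power series without constant term, $\Phi_j\big[\sum_{m\ge1}c_mz^m\big]=\sum_{m\ge1}c_m\Phi_j[z^m]$, wherever the latter series converges. With $(x)_+=\max(0,x)$ and $-(x)_-=\min(0,x)$ put $$\Omega_{j,k}(y_1,\dots,y_j,z_1,\dots,z_k)=\sum_{i=1}^j(y_i)_++\Big(-\sum_{i=1}^j(y_i)_-+\sum_{i=1}^k(z_i)_+\Big)_+ .$$ Let $\hat\phi(\eta)=\int_{\mathbb R}e^{-i\eta y}\phi(y)\,dy$, and let $$\mathcal F^{-1}[g](y,z)=(2\pi)^{-(j+k)}\int_{\mathbb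 R^j\times\mathbb R^k}e^{i(y\cdot\eta+z\cdot\zeta)}g(\eta,\zeta)\,d\eta\,d\zeta$$ be the inverse Fourier transform in $j+k$ variables. Then for all $a,b\in\mathbb C$ with $|a|,|b|<1$ and all $\alpha,\beta\in\mathbb R$, $$\sum_{p,q=1}^\infty a^pb^q\,\mathbb E\big[e^{i\alpha S_p+i\beta T_{p+q}}\big]=\sum_{j,k=1}^\infty\frac1{j!\,k!}\int_{\mathbb R^j\times\mathbb R^k}e^{i\alpha(y_1+\dots+y_j)+i\beta\Omega_{j,k}(y,z)}\,\mathcal F^{-1}\Big[\Phi_j\Big[\tfrac{as}{1-as}\Big]\big(\hat\phi(\eta_1),\dots,\hat\phi(\eta_j)\big)\,\Phi_k\Big[\tfrac{bt}{1-bt}\Big]\big(\hat\phi(\zeta_1),\dots,\hat\phi(\zeta_k)\big)\Big](y,z)\,dy\,dz,$$ where $\Phi_j$ and $\Phi_k$ act on functions of $s$ and $t$, respectively, and all the series and integrals (those defining $\Phi_j$, $\Phi_k$ and $\mathcal F^{-1}$ included) converge absolutely. -/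

import Mathlib

open MeasureTheory ProbabilityTheory
open scoped SchwartzMap

namespace WalkMax

noncomputable section

/-- The position `S_p = X_1 + ⋯ + X_p` of the walk; the step `X_{i+1}` is stored as `X i`. -/
def position {Ω : Type*} (X : ℕ → Ω → ℝ) (p : ℕ) (ω : Ω) : ℝ :=
  ∑ i ∈ Finset.range p, X i ω

/-- The running maximum `T_n = max (0, S_1, …, S_n)` (note `S_0 = 0`). -/
def runningMax {Ω : Type*} (X : ℕ → Ω → ℝ) (n : ℕ) (ω : Ω) : ℝ :=
  (Finset.range (n + 1)).sup' Finset.nonempty_range_add_one (fun k => position X k ω)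

/-- `Φ_j[z^m](x_1, …, x_j) = ∑_{l_1, …, l_j ≥ 1, l_1 + ⋯ + l_j = m} ∏_i x_i^{l_i} / l_i`,
which is an empty sum for `m < j`. -/
def phiMonomial (j m : ℕ) (x : Fin j → ℂ) : ℂ :=
  ∑ l ∈ (Finset.piAntidiag (Finset.univ : Finset (Fin j)) m).filter (fun l => ∀ i, 1 ≤ l i),
    ∏ i, x i ^ l i / (l i : ℂ)

/-- The `m`-th Taylor coefficient of `f` at the origin. -/
def taylorCoeff (f : ℂ → ℂ) (m : ℕ) : ℂ :=
  iteratedDeriv m f 0 / (m.factorial : ℂ)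

/-- The `j`-map `Φ_j`, extended linearly from the monomials along the Taylor series
`f(z) = ∑ c_m z^m` of a function analytic at the origin with `f(0) = 0`. -/
def Phi (j : ℕ) (f : ℂ → ℂ) (x : Fin j → ℂ) : ℂ :=
  ∑' m : ℕ, taylorCoeff f m * phiMonomial j m x

/-- The function `s ↦ a s / (1 - a s)`. -/
def geom (a : ℂ) : ℂ → ℂ := fun s => a * s / (1 - a * s)

/-- The piecewise linear weight `Ω_{j,k}`; here `(x)_+ = max 0 x` and `-(x)_- = min 0 x`. -/
def weight {j k : ℕ} (y : Fin j → ℝ) (z : Fin k → ℝ) : ℝ :=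
  ∑ i, max 0 (y i) + max 0 (∑ i, min 0 (y i) + ∑ i, max 0 (z i))

/-- `φ̂(η) = ∫ e^{-iηy} φ(y) dy`. -/
def hat (φ : ℝ → ℝ) (η : ℝ) : ℂ :=
  ∫ y : ℝ, Complex.exp (-(Complex.I * η * y)) * (φ y : ℂ)

/-- The inverse Fourier transform in all `j + k` variables,
`(2π)^{-(j+k)} ∫∫ e^{i(y·η + z·ζ)} g(η, ζ) dη dζ`. -/
def invFourier {j k : ℕ} (g : (Fin j → ℝ) × (Fin k → ℝ) → ℂ) (y : Fin j → ℝ) (z : Fin k → ℝ) : ℂ :=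
  (((2 * Real.pi) ^ (j + k))⁻¹ : ℝ) *
    ∫ v : (Fin j → ℝ) × (Fin k → ℝ),
      Complex.exp (Complex.I * ((∑ i, y i * v.1 i + ∑ i, z i * v.2 i : ℝ) : ℂ)) * g v

/-- The function of `(η, ζ)` to which the inverse Fourier transform is applied. -/
def symbol (φ : ℝ → ℝ) (a b : ℂ) (j k : ℕ) (v : (Fin j → ℝ) × (Fin k → ℝ)) : ℂ :=
  Phi j (geom a) (fun i => hat φ (v.1 i)) * Phi k (geom b) (fun i => hat φ (v.2 i))

/-- The integrand of the `(j, k)`-th term, as a function of `(y, z)`. -/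
def integrand (φ : ℝ → ℝ) (a b : ℂ) (α β : ℝ) (j k : ℕ) (w : (Fin j → ℝ) × (Fin k → ℝ)) : ℂ :=
  Complex.exp (Complex.I * ((α * ∑ i, w.1 i + β * weight w.1 w.2 : ℝ) : ℂ)) *
    invFourier (symbol φ a b j k) w.1 w.2

end

end WalkMax

/-! The proof rests on Spitzer's identity, taken at the level of measures rather than characteristic
functions. Finite measures on the plane form a commutative semiring under convolution. Let `ν` be
the law of `(X, X)` and let `P` be the pushforward under `(s, t) ↦ (s, t⁺)`. Splitting off the first
step shows that the law `Q n` of `(S_n, T_n)` satisfies `Q (n + 1) = P (ν * Q n)`. Since `P` obeys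
the Rota–Baxter identity of weight `-1` (`posPush_baxter`), this recursion has the solution `∑ Q n
zⁿ = exp (∑ P (ν ^ n) zⁿ / n)` (`walkLaw_eq_expCoeff`).

The last `q` steps are independent of the first `p`, and `T_{p+q} = max (T_p, S_p + T'_q)`, where
`T'_q` is the maximum of the walk restarted at time `p`. The expectation is thus the integral of one
bounded function against `Q p ⊗ Q q` (`integral_walk_eq`). Expanding both exponentials yields the
factors `1 / (j! k!)` and the `j`-th and `k`-th powers of the logarithmic series.

On the analytic side, `Φ_j[as/(1-as)]` is the product of the `-log (1 - a x_i)`, so the symbol is a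
tensor product. By Fourier inversion, the inverse transform of `-log (1 - a φ̂)` is `∑ aⁿ φ^{*n} /
n`. Its image under `y ↦ (y, y⁺)` is the logarithmic series evaluated at `a`
(`represents_logSeries`), and powers of that series become tensor powers of the density. The weight
`Ω_{j,k}` appears on adding up the points `(y_i, y_i⁺)` and `(z_i, z_i⁺)`.

Both sides sum one family indexed by `(j, k, p, q)`. Its absolute summability follows from total
masses (`summable_spitzerTerm`), and the order of summation is free. -/

namespace WalkMax

/-! ### Spitzer's recursion for Rota–Baxter operators -/

open Finset in
/-- Partial telescoping of Spitzer's recursion in a commutative semiring with an additive operator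
satisfying the Rota–Baxter identity of weight `-1`. -/
theorem baxter_telescope {R : Type*} [CommSemiring R] (P : R →+ R)
    (hP : ∀ m n, P m * P n + P (m * n) = P (P m * n) + P (m * P n))
    (x : R) (Q : ℕ → R) (hQ : ∀ n, Q (n + 1) = P (x * Q n)) (n i : ℕ) (hi : i ≤ n) :
    ∑ k ∈ range i, P (x ^ (k + 1)) * Q (n - k) + P (x ^ (i + 1) * Q (n - i)) =
      P (x * ∑ k ∈ range i, P (x ^ (k + 1)) * Q (n - 1 - k)) + Q (n + 1) := by
  induction i with
  | zero => simp [hQ]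
  | succ i ih =>
    have h1 : n - i = (n - (i + 1)) + 1 := by lia
    have h2 : n - 1 - i = n - (i + 1) := by lia
    -- The second argument is chosen so that its image under `P` is `Q (n - i)`.
    have hb := hP (x ^ (i + 1)) (x * Q (n - (i + 1)))
    rw [← hQ, ← h1] at hb
    rw [sum_range_succ, sum_range_succ, h2, add_assoc,
      show x ^ (i + 1 + 1) * Q (n - (i + 1)) = x ^ (i + 1) * (x * Q (n - (i + 1))) by ring, hb,
      mul_add, map_add, add_left_comm, ih (by lia),
      show P (x ^ (i + 1)) * (x * Q (n - (i + 1))) = x * (P (x ^ (i + 1)) * Q (n - (i + 1))) by ring]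
    ring

open Finset in
/-- Spitzer's recursion in a commutative semiring with a Rota–Baxter operator of weight `-1`. -/
theorem baxter_recursion {R : Type*} [CommSemiring R] (P : R →+ R)
    (hP : ∀ m n, P m * P n + P (m * n) = P (P m * n) + P (m * P n))
    (x : R) (Q : ℕ → R) (hQ0 : Q 0 = 1) (hQ : ∀ n, Q (n + 1) = P (x * Q n)) (n : ℕ) :
    (n + 1) • Q (n + 1) = ∑ k ∈ range (n + 1), P (x ^ (k + 1)) * Q (n - k) := by
  induction n with
  | zero => simp [hQ0, hQ]
  | succ n ih =>
    -- With `i` maximal, the leftover term is the last summand of the recursion, and the inner sum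
    -- on the right is the one evaluated by the induction hypothesis.
    have h := baxter_telescope P hP x Q hQ (n + 1) (n + 1) le_rfl
    rw [sum_range_succ]
    simp only [Nat.sub_self, hQ0, mul_one, add_tsub_cancel_right] at h ⊢
    rw [h, ← ih, mul_smul_comm, map_nsmul, ← hQ, succ_nsmul _ (n + 1)]

/-! ### Formal exponentials over a semiring -/

section Exponential

variable {R : Type*} [CommSemiring R]

open Finset PowerSeries in
theorem coeff_pow_of_lt {f : R⟦X⟧} (hf : coeff 0 f = 0) {j n : ℕ} (h : n < j) :
    coeff n (f ^ j) = 0 :=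
  coeff_of_lt_order _ ((Nat.cast_lt.2 h).trans_le
    (le_order_pow_of_constantCoeff_eq_zero j (by simpa using hf)))

variable [Algebra NNReal R]

/-- The `n`-th coefficient of `exp f` for a power series `f` without constant term. -/
noncomputable def expCoeff (f : PowerSeries R) (n : ℕ) : R :=
  ∑ j ∈ Finset.range (n + 1), ((j.factorial : NNReal)⁻¹) • PowerSeries.coeff n (f ^ j)

open Finset PowerSeries in
theorem expCoeff_eq_sum_range {f : R⟦X⟧} (hf : coeff 0 f = 0) {n N : ℕ} (h : n < N) :
    expCoeff f n = ∑ j ∈ range N, ((j.factorial : NNReal)⁻¹) • coeff n (f ^ j) := by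
  refine sum_subset (range_subset_range.2 h) fun j _ hj => ?_
  rw [coeff_pow_of_lt hf (by simpa using hj), smul_zero]

-- This is `(exp f)' = f' exp f` read off coefficientwise, from the derivative of each `f ^ (j + 1)
-- / (j + 1)!`. Measures cannot be subtracted, so the scalars that permit division by factorials are
-- nonnegative reals.
open Finset PowerSeries in
theorem expCoeff_recursion {f : R⟦X⟧} (hf : coeff 0 f = 0) (n : ℕ) :
    (n + 1) • expCoeff f (n + 1) =
      ∑ k ∈ range (n + 1), ((k + 1) • coeff (k + 1) f) * expCoeff f (n - k) := by
  have key (j : ℕ) : (n + 1) • (((j + 1).factorial : NNReal)⁻¹ • coeff (n + 1) (f ^ (j + 1))) =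
      ∑ k ∈ range (n + 1), ((k + 1) • coeff (k + 1) f) *
        ((j.factorial : NNReal)⁻¹ • coeff (n - k) (f ^ j)) := by
    have h1 : coeff n (d⁄dX R (f ^ (j + 1))) = (n + 1) • coeff (n + 1) (f ^ (j + 1)) := by
      rw [coeff_derivative, nsmul_eq_mul, mul_comm]; push_cast; rfl
    have h2 : ((j + 1).factorial : NNReal)⁻¹ * ((j + 1 : ℕ) : NNReal) =
        (j.factorial : NNReal)⁻¹ := by
      have : ((j + 1 : ℕ) : NNReal) ≠ 0 := by positivity
      rw [Nat.factorial_succ, Nat.cast_mul, mul_inv, mul_comm, ← mul_assoc, mul_inv_cancel₀ this,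
        one_mul]
    rw [smul_comm, ← h1, derivative_pow, Nat.add_sub_cancel,
      show ((j + 1 : ℕ) : R⟦X⟧) * f ^ j * d⁄dX R f = (j + 1) • (d⁄dX R f * f ^ j) by
        rw [nsmul_eq_mul]; ring, map_nsmul, ← Nat.cast_smul_eq_nsmul NNReal, smul_smul, h2,
      coeff_mul, Nat.sum_antidiagonal_eq_sum_range_succ_mk, smul_sum]
    refine sum_congr rfl fun k _ => ?_
    rw [mul_smul_comm, coeff_derivative, nsmul_eq_mul]
    push_cast; ring_nf
  rw [expCoeff, sum_range_succ', nsmul_add, smul_sum]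
  simp_rw [key]
  rw [sum_comm]
  have : coeff (n + 1) (f ^ 0) = 0 := by simp [coeff_one]
  rw [this, smul_zero, smul_zero, add_zero]
  refine sum_congr rfl fun k _ => ?_
  rw [expCoeff_eq_sum_range hf (show n - k < n + 1 by lia), mul_sum]

open Finset PowerSeries in
/-- A sequence satisfying the recursion of an exponential generating series is the sequence of
coefficients of that exponential. -/
theorem eq_expCoeff_of_recursion (C Q : ℕ → R) (hQ0 : Q 0 = 1)
    (hQ : ∀ n, (n + 1) • Q (n + 1) = ∑ k ∈ range (n + 1), C (k + 1) * Q (n - k)) (n : ℕ) :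
    Q n = expCoeff (PowerSeries.mk fun n => (n : NNReal)⁻¹ • C n) n := by
  have hc (n : ℕ) (x : R) : (((n + 1 : ℕ) : NNReal)⁻¹) • ((n + 1) • x) = x := by
    rw [← Nat.cast_smul_eq_nsmul NNReal, smul_smul, inv_mul_cancel₀ (by positivity), one_smul]
  induction n using Nat.strong_induction_on with
  | _ n ih =>
    cases n with
    | zero => simp [expCoeff, hQ0]
    | succ n =>
      rw [← hc n (Q (n + 1)), hQ, ← hc n (expCoeff _ (n + 1)), expCoeff_recursion (by simp)]
      congr 1
      refine sum_congr rfl fun k _ => ?_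
      rw [← ih _ (by lia), coeff_mk, smul_comm, hc]

end Exponential

/-! ### The convolution semiring of finite measures -/

section ConvolutionSemiring

variable {E : Type*} [AddCommMonoid E] [MeasurableSpace E] [MeasurableAdd₂ E]

/-- Finite measures on a commutative measurable monoid form a commutative semiring under
convolution. -/
noncomputable instance : CommSemiring (FiniteMeasure E) where
  mul m n := ⟨(m : Measure E).conv n, inferInstance⟩
  one := ⟨Measure.dirac 0, inferInstance⟩
  left_distrib _ _ _ := Subtype.ext (Measure.conv_add _ _ _)
  right_distrib _ _ _ := Subtype.ext (Measure.add_conv _ _ _)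
  zero_mul _ := Subtype.ext (Measure.zero_conv _)
  mul_zero _ := Subtype.ext (Measure.conv_zero _)
  mul_assoc _ _ _ := Subtype.ext (Measure.conv_assoc _ _ _)
  one_mul _ := Subtype.ext (Measure.dirac_zero_conv _)
  mul_one _ := Subtype.ext (Measure.conv_dirac_zero _)
  mul_comm _ _ := Subtype.ext (Measure.conv_comm _ _)

theorem toMeasure_mul (m n : FiniteMeasure E) :
    ((m * n : FiniteMeasure E) : Measure E) = (m : Measure E).conv n := rfl

theorem toMeasure_one : ((1 : FiniteMeasure E) : Measure E) = Measure.dirac 0 := rfl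

theorem smul_mul_finiteMeasure (c : NNReal) (m n : FiniteMeasure E) :
    (c • m) * n = c • (m * n) := by
  apply Subtype.ext
  change (((c • m : FiniteMeasure E) : Measure E)).conv n =
    ((c • (m * n) : FiniteMeasure E) : Measure E)
  rw [FiniteMeasure.toMeasure_smul, FiniteMeasure.toMeasure_smul, toMeasure_mul]
  exact Measure.conv_smul_left _ _ (c : ENNReal)

noncomputable instance : Algebra NNReal (FiniteMeasure E) :=
  Algebra.ofModule smul_mul_finiteMeasure fun c m n => by
    rw [mul_comm, smul_mul_finiteMeasure, mul_comm]

end ConvolutionSemiring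

/-! ### The positive-part operator and Spitzer's identity -/

/-- The map `(s, t) ↦ (s, t⁺)`. -/
def posPart (e : ℝ × ℝ) : ℝ × ℝ := (e.1, max 0 e.2)

@[fun_prop]
theorem measurable_posPart : Measurable posPart := by
  unfold posPart; fun_prop

/-- Pushforward of finite measures on the plane under `(s, t) ↦ (s, t⁺)`. -/
noncomputable def posPush : FiniteMeasure (ℝ × ℝ) →+ FiniteMeasure (ℝ × ℝ) where
  toFun m := ⟨(m : Measure (ℝ × ℝ)).map posPart, inferInstance⟩
  map_zero' := Subtype.ext (Measure.map_zero _)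
  map_add' _ _ := Subtype.ext (Measure.map_add _ _ measurable_posPart)

theorem toMeasure_posPush (m : FiniteMeasure (ℝ × ℝ)) :
    (posPush m : Measure (ℝ × ℝ)) = (m : Measure (ℝ × ℝ)).map posPart := rfl

/-- The pointwise Rota–Baxter identity: the two points on the left of `posPush_baxter` and the two
on the right agree as unordered pairs. Which matching occurs depends on the signs of the second
coordinates. -/
theorem posPart_add_or (x y : ℝ × ℝ) :
    (posPart x + posPart y = posPart (posPart x + y) ∧
      posPart (x + y) = posPart (x + posPart y)) ∨
    (posPart x + posPart y = posPart (x + posPart y) ∧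
      posPart (x + y) = posPart (posPart x + y)) := by
  obtain ⟨x1, x⟩ := x
  obtain ⟨y1, y⟩ := y
  simp only [posPart, Prod.mk_add_mk, Prod.mk.injEq, true_and]
  grind

theorem posPush_baxter (m n : FiniteMeasure (ℝ × ℝ)) :
    posPush m * posPush n + posPush (m * n) =
      posPush (posPush m * n) + posPush (m * posPush n) := by
  apply Subtype.ext
  change (posPush m : Measure (ℝ × ℝ)).conv (posPush n) + ((m : Measure _).conv n).map posPart =
    ((posPush m : Measure (ℝ × ℝ)).conv n).map posPart +
      ((m : Measure (ℝ × ℝ)).conv (posPush n)).map posPart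
  simp only [toMeasure_posPush]
  refine Measure.ext_of_lintegral _ fun f hf => ?_
  have hp := measurable_posPart
  simp only [lintegral_add_measure]
  rw [lintegral_map hf hp, lintegral_map hf hp, lintegral_map hf hp,
    Measure.lintegral_conv hf, Measure.lintegral_conv (by fun_prop),
    Measure.lintegral_conv (by fun_prop), Measure.lintegral_conv (by fun_prop),
    lintegral_map (by fun_prop) hp, lintegral_map (by fun_prop) hp,
    ← lintegral_add_left (by fun_prop), ← lintegral_add_left (by fun_prop)]
  refine lintegral_congr fun x => ?_
  rw [lintegral_map (by fun_prop) hp, lintegral_map (by fun_prop) hp,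
    ← lintegral_add_left (by fun_prop), ← lintegral_add_left (by fun_prop)]
  refine lintegral_congr fun y => ?_
  rcases posPart_add_or x y with ⟨h1, h2⟩ | ⟨h1, h2⟩
  · rw [h1, h2]
  · rw [h1, h2, add_comm]

/-- The law of `(S_n, T_n)` for a walk with step law `ν`, where `ν` is embedded in the plane as the
law of `(X, X)`. -/
noncomputable def walkLaw (ν : FiniteMeasure (ℝ × ℝ)) : ℕ → FiniteMeasure (ℝ × ℝ)
  | 0 => 1
  | n + 1 => posPush (ν * walkLaw ν n)

/-- The generating series `∑ P(ν^n) X^n / n`. -/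
noncomputable def logSeries (ν : FiniteMeasure (ℝ × ℝ)) : PowerSeries (FiniteMeasure (ℝ × ℝ)) :=
  PowerSeries.mk fun n => (n : NNReal)⁻¹ • posPush (ν ^ n)

/-- Spitzer's identity for the joint law of position and maximum. -/
theorem walkLaw_eq_expCoeff (ν : FiniteMeasure (ℝ × ℝ)) (n : ℕ) :
    walkLaw ν n = expCoeff (logSeries ν) n :=
  eq_expCoeff_of_recursion (fun k => posPush (ν ^ k)) (walkLaw ν) rfl
    (baxter_recursion posPush posPush_baxter ν (walkLaw ν) rfl fun _ => rfl) n

/-! ### Path decompositions and the law of position and maximum -/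

section Walk

variable {Ω : Type*}

theorem position_congr {Ω' : Type*} {X : ℕ → Ω → ℝ} {Y : ℕ → Ω' → ℝ} {n : ℕ} {ω : Ω} {ω' : Ω'}
    (h : ∀ i < n, X i ω = Y i ω') : position X n ω = position Y n ω' :=
  Finset.sum_congr rfl fun i hi => h i (Finset.mem_range.1 hi)

theorem runningMax_congr {Ω' : Type*} {X : ℕ → Ω → ℝ} {Y : ℕ → Ω' → ℝ} {n : ℕ} {ω : Ω} {ω' : Ω'}
    (h : ∀ i < n, X i ω = Y i ω') : runningMax X n ω = runningMax Y n ω' :=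
  Finset.sup'_congr _ rfl fun _ hk => position_congr fun i hi =>
    h i (hi.trans_le (Nat.lt_succ_iff.1 (Finset.mem_range.1 hk)))

theorem position_add (X : ℕ → Ω → ℝ) (p q : ℕ) (ω : Ω) :
    position X (p + q) ω = position X p ω + position (fun i => X (p + i)) q ω :=
  Finset.sum_range_add _ p q

theorem runningMax_add (X : ℕ → Ω → ℝ) (p q : ℕ) (ω : Ω) :
    runningMax X (p + q) ω =
      max (runningMax X p ω) (position X p ω + runningMax (fun i => X (p + i)) q ω) := by
  apply le_antisymm
  · refine Finset.sup'_le _ _ fun k hk => ?_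
    rcases le_or_gt k p with h | h
    · exact le_max_of_le_left (Finset.le_sup' (fun k => position X k ω) (by simp; lia))
    · obtain ⟨r, rfl⟩ := Nat.exists_eq_add_of_le h.le
      rw [position_add]
      refine le_max_of_le_right (add_le_add le_rfl ?_)
      exact Finset.le_sup' (fun k => position (fun i => X (p + i)) k ω) (by simp at hk ⊢; lia)
  · refine max_le (Finset.sup'_le _ _ fun k hk => ?_) ?_
    · exact Finset.le_sup' (fun k => position X k ω) (by simp at hk ⊢; lia)
    · rw [← le_sub_iff_add_le']
      refine Finset.sup'_le _ _ fun k hk => ?_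
      rw [le_sub_iff_add_le', ← position_add]
      exact Finset.le_sup' (fun k => position X k ω) (by simp at hk ⊢; lia)

/-- The pair `(S_n, T_n)`. -/
noncomputable def walkState (X : ℕ → Ω → ℝ) (n : ℕ) (ω : Ω) : ℝ × ℝ :=
  (position X n ω, runningMax X n ω)

/-- Only the first `n` steps matter. This allows steps to be replaced by measurable versions, or by
coordinates of a finite vector. -/
theorem walkState_congr {Ω' : Type*} {X : ℕ → Ω → ℝ} {Y : ℕ → Ω' → ℝ} {n : ℕ} {ω : Ω} {ω' : Ω'}
    (h : ∀ i < n, X i ω = Y i ω') : walkState X n ω = walkState Y n ω' :=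
  Prod.ext (position_congr h) (runningMax_congr h)

/-- It is the first step that is split off: the maximum of the remaining walk is nonnegative, so
`max (max 0 X_1) (X_1 + T')` collapses to `(X_1 + T')⁺`. -/
theorem walkState_succ (X : ℕ → Ω → ℝ) (n : ℕ) (ω : Ω) :
    walkState X (n + 1) ω =
      posPart ((X 0 ω, X 0 ω) + walkState (fun i => X (1 + i)) n ω) := by
  have h1 := runningMax_add X 1 n ω
  have h2 := position_add X 1 n ω
  have h3 : position X 1 ω = X 0 ω := by simp [position]
  have h4 : runningMax X 1 ω = max 0 (X 0 ω) := by
    simp [runningMax, position, Finset.range_add_one, max_comm]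
  have h5 : 0 ≤ runningMax (fun i => X (1 + i)) n ω :=
    Finset.le_sup'_of_le _ (b := 0) (by simp) (by simp [position])
  rw [walkState, add_comm n 1, h1, h2, h3, h4]
  ext
  · simp [posPart, walkState]
  · simp only [posPart, walkState, Prod.mk_add_mk]
    grind

variable [MeasurableSpace Ω]

theorem measurable_walkState {X : ℕ → Ω → ℝ} (hX : ∀ i, Measurable (X i)) (n : ℕ) :
    Measurable (walkState X n) := by
  have hp (k : ℕ) : Measurable (position X k) := Finset.measurable_fun_sum _ fun i _ => hX i
  refine (hp n).prodMk ?_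
  exact Finset.measurable_range_sup'' fun k _ => hp k

/-- The states of a walk over two disjoint time intervals are functions of disjoint sets of
steps. -/
theorem indepFun_walkState {μ : Measure Ω} [IsProbabilityMeasure μ] {X : ℕ → Ω → ℝ}
    (hX : ∀ i, AEMeasurable (X i) μ) (hindep : iIndepFun X μ) (p q : ℕ) :
    IndepFun (walkState X p) (walkState (fun i => X (p + i)) q) μ := by
  classical
  have h := hindep.indepFun_finset₀ (Finset.range p) (Finset.Ico p (p + q))
    (by rw [Finset.disjoint_left]; intro i; simp; lia) hX
  -- Extension by zero turns a vector indexed by `s` into a full sequence of steps, to which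
  -- `walkState` applies.
  let ext (s : Finset ℕ) (i : ℕ) (v : s → ℝ) : ℝ := if hi : i ∈ s then v ⟨i, hi⟩ else 0
  have hext (s : Finset ℕ) (i : ℕ) : Measurable (ext s i) := by
    by_cases hi : i ∈ s
    · simp only [ext, hi, dif_pos]; fun_prop
    · simp only [ext, hi, dif_neg, not_false_iff]; fun_prop
  have h' := h.comp (measurable_walkState (fun i => hext (Finset.range p) i) p)
    (measurable_walkState (fun i => hext (Finset.Ico p (p + q)) (p + i)) q)
  convert h' using 1
  · ext1 ω
    refine walkState_congr fun i hi => ?_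
    simp [ext, hi]
  · ext1 ω
    refine walkState_congr fun i hi => ?_
    simp [ext, hi]

theorem aemeasurable_walkState {μ : Measure Ω} {X : ℕ → Ω → ℝ}
    (hX : ∀ i, AEMeasurable (X i) μ) (n : ℕ) : AEMeasurable (walkState X n) μ := by
  refine ⟨walkState (fun i => (hX i).mk _) n,
    measurable_walkState (fun i => (hX i).measurable_mk) n, ?_⟩
  filter_upwards [ae_all_iff.2 fun i => (hX i).ae_eq_mk] with ω hω
  exact walkState_congr fun i _ => hω i

/-- The law of `(S_n, T_n)` is given by the convolution recursion. -/
theorem map_walkState {μ : Measure Ω} [IsProbabilityMeasure μ] {ν : FiniteMeasure (ℝ × ℝ)} (n : ℕ) :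
    ∀ {X : ℕ → Ω → ℝ}, (∀ i, AEMeasurable (X i) μ) → iIndepFun X μ →
      (∀ i, μ.map (fun ω => (X i ω, X i ω)) = ν) → μ.map (walkState X n) = walkLaw ν n := by
  induction n with
  | zero =>
    intro X _ _ _
    have : walkState X 0 = fun _ => 0 := by ext <;> simp [walkState, position, runningMax]
    rw [this, Measure.map_const]
    simp [walkLaw, toMeasure_one]
  | succ n ih =>
    intro X hX hindep hν
    have hX' : ∀ i, AEMeasurable (X (1 + i)) μ := fun i => hX _
    have h := ih hX' (hindep.precomp (add_right_injective 1)) fun i => hν _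
    have hind : IndepFun (fun ω => (X 0 ω, X 0 ω)) (walkState (fun i => X (1 + i)) n) μ := by
      have h1 := (indepFun_walkState hX hindep 1 n).comp
        (φ := fun e : ℝ × ℝ => (e.1, e.1)) (ψ := id) (by fun_prop) measurable_id
      have h2 : (fun e : ℝ × ℝ => (e.1, e.1)) ∘ walkState X 1 = fun ω => (X 0 ω, X 0 ω) := by
        ext1 ω; simp [walkState, position]
      rwa [h2] at h1
    have h0 : AEMeasurable (fun ω => (X 0 ω, X 0 ω)) μ := (hX 0).prodMk (hX 0)
    have hsum := hind.map_add_eq_map_conv_map₀ h0 (aemeasurable_walkState hX' n)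
    have : walkState X (n + 1) = posPart ∘
        ((fun ω => (X 0 ω, X 0 ω)) + walkState (fun i => X (1 + i)) n) := by
      ext1 ω; exact walkState_succ X n ω
    rw [this, ← AEMeasurable.map_map_of_aemeasurable measurable_posPart.aemeasurable
      (h0.add (aemeasurable_walkState hX' n)), hsum, hν, h]
    rfl

end Walk

/-! ### The maps `Φ_j` and products of logarithms -/

/-- The power series `f` converges absolutely at `z`, with sum `v`. -/
def HasAbsEval (f : PowerSeries ℂ) (z v : ℂ) : Prop :=
  (Summable fun n => ‖PowerSeries.coeff n f * z ^ n‖) ∧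
    HasSum (fun n => PowerSeries.coeff n f * z ^ n) v

theorem coeff_mul_mul_pow (f g : PowerSeries ℂ) (z : ℂ) (n : ℕ) :
    PowerSeries.coeff n (f * g) * z ^ n = ∑ kl ∈ Finset.HasAntidiagonal.antidiagonal n,
      (PowerSeries.coeff kl.1 f * z ^ kl.1) * (PowerSeries.coeff kl.2 g * z ^ kl.2) := by
  rw [PowerSeries.coeff_mul, Finset.sum_mul]
  refine Finset.sum_congr rfl fun kl h => ?_
  rw [← Finset.HasAntidiagonal.mem_antidiagonal.1 h, pow_add]
  ring

theorem HasAbsEval.mul {f g : PowerSeries ℂ} {z v w : ℂ} (hf : HasAbsEval f z v)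
    (hg : HasAbsEval g z w) : HasAbsEval (f * g) z (v * w) := by
  have h := summable_norm_sum_mul_antidiagonal_of_summable_norm hf.1 hg.1
  simp_rw [← coeff_mul_mul_pow] at h
  refine ⟨h, ?_⟩
  have h' := tsum_mul_tsum_eq_tsum_sum_antidiagonal_of_summable_norm hf.1 hg.1
  simp_rw [← coeff_mul_mul_pow] at h'
  rw [← hf.2.tsum_eq, ← hg.2.tsum_eq, h']
  exact h.of_norm.hasSum

theorem HasAbsEval.one (z : ℂ) : HasAbsEval 1 z 1 := by
  have h : ∀ n ≠ 0, PowerSeries.coeff n (1 : PowerSeries ℂ) * z ^ n = 0 := fun n hn => by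
    simp [PowerSeries.coeff_one, hn]
  refine ⟨summable_of_ne_finset_zero (s := {0}) fun n hn => ?_, ?_⟩
  · rw [h n (by simpa using hn), norm_zero]
  · simpa using hasSum_single (f := fun n => PowerSeries.coeff n (1 : PowerSeries ℂ) * z ^ n) 0 h

theorem HasAbsEval.prod {ι : Type*} (s : Finset ι) {f : ι → PowerSeries ℂ} {z : ℂ} {v : ι → ℂ}
    (h : ∀ i ∈ s, HasAbsEval (f i) z (v i)) : HasAbsEval (∏ i ∈ s, f i) z (∏ i ∈ s, v i) := by
  classical
  induction s using Finset.induction_on with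
  | empty => simpa using HasAbsEval.one z
  | insert i s hi ih =>
    rw [Finset.prod_insert hi, Finset.prod_insert hi]
    exact (h i (by simp)).mul (ih fun k hk => h k (by simp [hk]))

/-- The power series `∑ xⁿ zⁿ / n`. -/
noncomputable def negLogSeries (x : ℂ) : PowerSeries ℂ := PowerSeries.mk fun n => x ^ n / (n : ℂ)

theorem hasAbsEval_negLogSeries {x a : ℂ} (h : ‖a * x‖ < 1) :
    HasAbsEval (negLogSeries x) a (-Complex.log (1 - a * x)) := by
  have e (n : ℕ) : PowerSeries.coeff n (negLogSeries x) * a ^ n = (a * x) ^ n / n := by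
    rw [negLogSeries, PowerSeries.coeff_mk, mul_pow]; ring
  have hs := Complex.hasSum_taylorSeries_neg_log h
  unfold HasAbsEval
  simp_rw [e]
  exact ⟨hs.summable.norm, hs⟩

theorem phiMonomial_eq_coeff (j m : ℕ) (x : Fin j → ℂ) :
    phiMonomial j m x = PowerSeries.coeff m (∏ i, negLogSeries (x i)) := by
  rw [phiMonomial, PowerSeries.coeff_prod, Finset.sum_filter_of_ne]
  · refine Finset.sum_bij' (fun l _ => Finsupp.equivFunOnFinite.symm l) (fun l _ => ⇑l)
      ?_ ?_ ?_ ?_ ?_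
    · intro l hl; simpa using hl
    · intro l hl; simpa using hl
    · intro l _; rfl
    · intro l _; ext; rfl
    · intro l _; simp [negLogSeries]
  -- Dropping the constraint `1 ≤ l i` is harmless, because `x ^ 0 / 0 = 0`.
  · intro l _ h i
    rw [Finset.prod_ne_zero_iff] at h
    by_contra hi
    apply h i (Finset.mem_univ i)
    rw [show l i = 0 by lia]; simp

/-- Uniqueness of power series: near the origin the function is the geometric series with its
constant term removed. -/
theorem taylorCoeff_geom (a : ℂ) (m : ℕ) :
    taylorCoeff (geom a) m = if m = 0 then 0 else a ^ m := by
  have hev : ∀ᶠ z : ℂ in nhds 0, ‖a * z‖ < 1 := by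
    have : ContinuousAt (fun z : ℂ => ‖a * z‖) 0 := by fun_prop
    exact this.eventually (gt_mem_nhds (by simp))
  have h1 : HasFPowerSeriesAt (geom a)
      (FormalMultilinearSeries.ofScalars ℂ fun n => if n = 0 then 0 else a ^ n) 0 := by
    rw [hasFPowerSeriesAt_iff]
    filter_upwards [hev] with z hz
    have hg := (hasSum_geometric_of_norm_lt_one hz).sub (hasSum_ite_eq 0 (1 : ℂ))
    have hne : 1 - a * z ≠ 0 := by
      intro h0
      rw [← sub_eq_zero.1 h0] at hz
      simp at hz
    convert hg using 1
    · ext n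
      rcases eq_or_ne n 0 with rfl | hn
      · simp [FormalMultilinearSeries.coeff_ofScalars]
      · simp [FormalMultilinearSeries.coeff_ofScalars, hn, mul_pow, mul_comm]
    · rw [geom, zero_add]
      field_simp
      ring
  have h2 := h1.analyticAt.hasFPowerSeriesAt.eq_formalMultilinearSeries h1
  have h3 := congrArg (fun p => FormalMultilinearSeries.coeff p m) h2
  simpa [FormalMultilinearSeries.coeff_ofScalars, taylorCoeff] using h3

/-- At `m = 0` the Taylor coefficient vanishes while `a ^ 0 = 1`; the two sides agree because a
nonempty product of series without constant term has none. -/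
theorem taylorCoeff_geom_mul_phiMonomial (a : ℂ) {j : ℕ} (hj : 1 ≤ j) (m : ℕ) (x : Fin j → ℂ) :
    taylorCoeff (geom a) m * phiMonomial j m x =
      PowerSeries.coeff m (∏ i, negLogSeries (x i)) * a ^ m := by
  rw [taylorCoeff_geom, phiMonomial_eq_coeff]
  split_ifs with hm
  · subst hm
    rw [zero_mul, PowerSeries.coeff_zero_eq_constantCoeff_apply, map_prod,
      Finset.prod_eq_zero (Finset.mem_univ ⟨0, hj⟩), zero_mul]
    simp [negLogSeries, ← PowerSeries.coeff_zero_eq_constantCoeff_apply]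
  · rw [mul_comm]

/-- `Φ_j[as/(1-as)]` converges and factors into logarithms. -/
theorem hasSum_Phi_geom (a : ℂ) {j : ℕ} (hj : 1 ≤ j) {x : Fin j → ℂ} (hx : ∀ i, ‖a * x i‖ < 1) :
    HasSum (fun m => taylorCoeff (geom a) m * phiMonomial j m x)
      (∏ i, -Complex.log (1 - a * x i)) := by
  simp_rw [taylorCoeff_geom_mul_phiMonomial a hj]
  exact (HasAbsEval.prod _ fun i _ => hasAbsEval_negLogSeries (hx i)).2

/-! ### Convolution powers of the density and Fourier inversion -/

open scoped FourierTransform ComplexOrder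

/-- The complexification of a real Schwartz function. -/
noncomputable def toComplex (φ : 𝓢(ℝ, ℝ)) : 𝓢(ℝ, ℂ) :=
  SchwartzMap.postcompCLM (𝕜 := ℝ) Complex.ofRealCLM φ

@[simp]
theorem toComplex_apply (φ : 𝓢(ℝ, ℝ)) (x : ℝ) : toComplex φ x = (φ x : ℂ) := rfl

/-- The `(n+1)`-fold convolution power of a Schwartz function. -/
noncomputable def convPow (f : 𝓢(ℝ, ℂ)) : ℕ → 𝓢(ℝ, ℂ)
  | 0 => f
  | n + 1 => SchwartzMap.convolution (ContinuousLinearMap.mul ℂ ℂ) f (convPow f n)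

theorem fourier_convPow (f : 𝓢(ℝ, ℂ)) (n : ℕ) (x : ℝ) :
    (𝓕 (convPow f n)) x = (𝓕 f) x ^ (n + 1) := by
  induction n with
  | zero => simp [convPow]
  | succ n ih =>
    rw [convPow, SchwartzMap.fourier_convolution, SchwartzMap.pairing_apply_apply, ih]
    simp [pow_succ']

theorem convPow_succ_apply (f : 𝓢(ℝ, ℂ)) (n : ℕ) (x : ℝ) :
    convPow f (n + 1) x = ∫ t, f t * convPow f n (x - t) :=
  SchwartzMap.convolution_apply _ _ _ _

theorem hat_eq_fourier (φ : 𝓢(ℝ, ℝ)) (η : ℝ) :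
    hat φ η = (𝓕 (toComplex φ)) ((2 * Real.pi)⁻¹ * η) := by
  rw [SchwartzMap.fourier_coe, Real.fourier_real_eq_integral_exp_smul, hat]
  refine integral_congr_ae (Filter.Eventually.of_forall fun y => ?_)
  simp only [toComplex_apply, smul_eq_mul]
  congr 2
  have : (Real.pi : ℂ) ≠ 0 := by exact_mod_cast Real.pi_ne_zero
  push_cast
  field_simp

theorem continuous_hat (φ : 𝓢(ℝ, ℝ)) : Continuous (hat φ) := by
  rw [show hat φ = _ from funext (hat_eq_fourier φ)]
  exact (𝓕 (toComplex φ)).continuous.comp (by fun_prop)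

theorem integrable_hat (φ : 𝓢(ℝ, ℝ)) : Integrable (hat φ) := by
  rw [show hat φ = _ from funext (hat_eq_fourier φ)]
  exact (𝓕 (toComplex φ)).integrable.comp_mul_left' (by positivity)

theorem norm_hat_le_one {φ : 𝓢(ℝ, ℝ)} (hφ : ∀ x, 0 ≤ φ x) (h1 : ∫ x, φ x = 1) (η : ℝ) :
    ‖hat φ η‖ ≤ 1 := by
  rw [← h1]
  refine (norm_integral_le_integral_norm _).trans_eq (integral_congr_ae ?_)
  refine Filter.Eventually.of_forall fun y => ?_
  have : -(Complex.I * η * y) = ((-(η * y) : ℝ) : ℂ) * Complex.I := by push_cast; ring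
  simp only [norm_mul, this, Complex.norm_exp_ofReal_mul_I, one_mul, Complex.norm_real,
    Real.norm_of_nonneg (hφ y)]

/-- Fourier inversion for a Schwartz function. The substitution `η = 2πξ` passes between the two
normalizations and absorbs the factor `(2π)⁻¹`. -/
theorem inverse_hat_pow (φ : 𝓢(ℝ, ℝ)) (n : ℕ) (y : ℝ) :
    ((2 * Real.pi)⁻¹ : ℝ) * ∫ η : ℝ, Complex.exp (Complex.I * ((y * η : ℝ) : ℂ)) *
      hat φ η ^ (n + 1) = convPow (toComplex φ) n y := by
  have h := Measure.integral_comp_mul_left (fun η : ℝ =>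
    Complex.exp (Complex.I * ((y * η : ℝ) : ℂ)) * hat φ η ^ (n + 1)) (2 * Real.pi)
  rw [abs_of_nonneg (by positivity), Complex.real_smul] at h
  rw [← h, show convPow (toComplex φ) n = 𝓕⁻ (𝓕 (convPow (toComplex φ) n)) by simp,
    SchwartzMap.fourierInv_coe, Real.fourierInv_eq']
  refine integral_congr_ae (Filter.Eventually.of_forall fun ξ => ?_)
  simp only [smul_eq_mul]
  rw [fourier_convPow, hat_eq_fourier, inv_mul_cancel_left₀ (by positivity)]
  congr 2
  simp only [RCLike.inner_apply, conj_trivial]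
  push_cast
  ring

theorem convPow_toComplex_nonneg {φ : 𝓢(ℝ, ℝ)} (hφ : ∀ x, 0 ≤ φ x) (n : ℕ) (x : ℝ) :
    0 ≤ convPow (toComplex φ) n x := by
  induction n generalizing x with
  | zero => simpa [convPow] using hφ x
  | succ n ih =>
    rw [convPow_succ_apply]
    refine integral_nonneg fun t => mul_nonneg ?_ (ih _)
    simpa using hφ t

/-- Integration against a convolution power, as an iterated integral. -/
theorem integral_mul_convPow_succ (f : 𝓢(ℝ, ℂ)) (n : ℕ) {F : ℝ → ℂ} (hF : Measurable F) {K : ℝ}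
    (hK : ∀ x, ‖F x‖ ≤ K) :
    ∫ x, F x * convPow f (n + 1) x = ∫ t, f t * ∫ y, F (t + y) * convPow f n y := by
  have hint := f.integrable.convolution_integrand (ContinuousLinearMap.mul ℂ ℂ)
    (convPow f n).integrable (μ := volume) (ν := volume)
  have hint' : Integrable (fun p : ℝ × ℝ => F p.1 * (f p.2 * convPow f n (p.1 - p.2)))
      (volume.prod volume) :=
    hint.bdd_mul (hF.comp measurable_fst).aestronglyMeasurable
      (Filter.Eventually.of_forall fun p => hK p.1)
  simp_rw [convPow_succ_apply, ← integral_const_mul]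
  rw [integral_integral_swap hint']
  refine integral_congr_ae (Filter.Eventually.of_forall fun t => ?_)
  simp only
  rw [← integral_add_left_eq_self _ t]
  refine integral_congr_ae (Filter.Eventually.of_forall fun y => ?_)
  simp only [add_sub_cancel_left]
  ring

theorem norm_exp_I_mul_ofReal (r : ℝ) : ‖Complex.exp (Complex.I * (r : ℂ))‖ = 1 := by
  rw [mul_comm, Complex.norm_exp_ofReal_mul_I]

/-! ### The density with transform `-log (1 - a φ̂)` -/

/-- The inverse Fourier transform of `-log (1 - a φ̂)`. -/
noncomputable def logDensity (φ : ℝ → ℝ) (a : ℂ) (y : ℝ) : ℂ :=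
  ((2 * Real.pi)⁻¹ : ℝ) * ∫ η : ℝ, Complex.exp (Complex.I * ((y * η : ℝ) : ℂ)) *
    -Complex.log (1 - a * hat φ η)

theorem norm_mul_hat_le {φ : 𝓢(ℝ, ℝ)} (hφ : ∀ x, 0 ≤ φ x) (h1 : ∫ x, φ x = 1) (a : ℂ) (η : ℝ) :
    ‖a * hat φ η‖ ≤ ‖a‖ := by
  rw [norm_mul]
  exact mul_le_of_le_one_right (norm_nonneg _) (norm_hat_le_one hφ h1 η)

theorem integral_convPow {φ : 𝓢(ℝ, ℝ)} (h1 : ∫ x, φ x = 1) (n : ℕ) :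
    ∫ x, convPow (toComplex φ) n x = 1 := by
  have h0 : ∫ x, toComplex φ x = 1 := by
    simp only [toComplex_apply, integral_complex_ofReal, h1, Complex.ofReal_one]
  induction n with
  | zero => exact h0
  | succ n ih =>
    have := integral_mul_convPow_succ (toComplex φ) n (F := fun _ => 1) measurable_const
      (K := 1) (by simp)
    simp only [one_mul, ih, mul_one] at this
    exact this.trans h0

theorem integral_norm_convPow {φ : 𝓢(ℝ, ℝ)} (hφ : ∀ x, 0 ≤ φ x) (h1 : ∫ x, φ x = 1) (n : ℕ) :
    ∫ x, ‖convPow (toComplex φ) n x‖ = 1 := by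
  have h := integral_convPow h1 n
  have e (x : ℝ) : convPow (toComplex φ) n x = ((‖convPow (toComplex φ) n x‖ : ℝ) : ℂ) :=
    (RCLike.norm_of_nonneg' (K := ℂ) (convPow_toComplex_nonneg hφ n x)).symm
  rw [integral_congr_ae (Filter.Eventually.of_forall e), integral_complex_ofReal] at h
  exact_mod_cast h

/-- A series of integrable functions with summable `L¹` norms has an integrable sum. -/
theorem integrable_of_hasSum {α : Type*} [MeasurableSpace α] {m : Measure α} {F : ℕ → α → ℂ}
    {f : α → ℂ} (hF : ∀ n, Integrable (F n) m) (hs : Summable fun n => ∫ x, ‖F n x‖ ∂m)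
    (hf : ∀ x, HasSum (fun n => F n x) (f x)) : Integrable f m := by
  refine ⟨aestronglyMeasurable_of_tendsto_ae Filter.atTop
    (f := fun N x => ∑ n ∈ Finset.range N, F n x)
    (fun N => Finset.aestronglyMeasurable_fun_sum _ fun n _ => (hF n).aestronglyMeasurable)
    (Filter.Eventually.of_forall fun x => (hf x).tendsto_sum_nat), ?_⟩
  have hle (x : α) : ‖f x‖ₑ ≤ ∑' n, ‖F n x‖ₑ := by
    rw [← (hf x).tsum_eq]; exact enorm_tsum_le_tsum_enorm
  refine (lintegral_mono hle).trans_lt ?_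
  rw [lintegral_tsum fun n => (hF n).aestronglyMeasurable.enorm]
  simp_rw [fun n => (ofReal_integral_norm_eq_lintegral_enorm (hF n)).symm]
  rw [← ENNReal.ofReal_tsum_of_nonneg (fun n => integral_nonneg fun _ => norm_nonneg _) hs]
  exact ENNReal.ofReal_lt_top

theorem summable_pow_div {a : ℂ} (ha : ‖a‖ < 1) : Summable fun n : ℕ => ‖a ^ n / (n : ℂ)‖ :=
  (Complex.hasSum_taylorSeries_neg_log ha).summable.norm

theorem hasSum_neg_log {φ : 𝓢(ℝ, ℝ)} (hφ : ∀ x, 0 ≤ φ x) (h1 : ∫ x, φ x = 1) {a : ℂ}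
    (ha : ‖a‖ < 1) (η : ℝ) :
    HasSum (fun n : ℕ => a ^ n / (n : ℂ) * hat φ η ^ n) (-Complex.log (1 - a * hat φ η)) := by
  have := Complex.hasSum_taylorSeries_neg_log ((norm_mul_hat_le hφ h1 a η).trans_lt ha)
  convert this using 2 with n
  rw [mul_pow]; ring

/-- One factor `‖φ̂‖` is kept to have an integrable majorant; the others are at most `1`. At `n = 0`
division by zero makes the term vanish, although `φ̂ ^ 0` is not integrable. -/
theorem norm_pow_div_mul_hat_pow_le {φ : 𝓢(ℝ, ℝ)} (hφ : ∀ x, 0 ≤ φ x) (h1 : ∫ x, φ x = 1) (a : ℂ)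
    (n : ℕ) (η : ℝ) : ‖a ^ n / (n : ℂ) * hat φ η ^ n‖ ≤ ‖a ^ n / (n : ℂ)‖ * ‖hat φ η‖ := by
  rcases eq_or_ne n 0 with rfl | hn
  · simp
  · rw [norm_mul, norm_pow (hat φ η)]
    gcongr
    exact pow_le_of_le_one (norm_nonneg _) (norm_hat_le_one hφ h1 η) hn

theorem integrable_pow_div_mul_hat_pow {φ : 𝓢(ℝ, ℝ)} (hφ : ∀ x, 0 ≤ φ x) (h1 : ∫ x, φ x = 1)
    (a : ℂ) (n : ℕ) : Integrable fun η => a ^ n / (n : ℂ) * hat φ η ^ n := by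
  have := continuous_hat φ
  refine Integrable.mono' ((integrable_hat φ).norm.const_mul ‖a ^ n / (n : ℂ)‖)
    (by fun_prop) (Filter.Eventually.of_forall fun η => ?_)
  exact norm_pow_div_mul_hat_pow_le hφ h1 a n η

theorem summable_integral_norm_hat_pow {φ : 𝓢(ℝ, ℝ)} (hφ : ∀ x, 0 ≤ φ x) (h1 : ∫ x, φ x = 1) {a : ℂ}
    (ha : ‖a‖ < 1) : Summable fun n : ℕ => ∫ η, ‖a ^ n / (n : ℂ) * hat φ η ^ n‖ := by
  refine Summable.of_nonneg_of_le (fun n => integral_nonneg fun _ => norm_nonneg _) (fun n => ?_)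
    ((summable_pow_div ha).mul_right (∫ η, ‖hat φ η‖))
  rw [← integral_const_mul]
  exact integral_mono (integrable_pow_div_mul_hat_pow hφ h1 a n).norm
    ((integrable_hat φ).norm.const_mul _) fun η => norm_pow_div_mul_hat_pow_le hφ h1 a n η

theorem integrable_neg_log_hat {φ : 𝓢(ℝ, ℝ)} (hφ : ∀ x, 0 ≤ φ x) (h1 : ∫ x, φ x = 1) {a : ℂ}
    (ha : ‖a‖ < 1) : Integrable fun η => -Complex.log (1 - a * hat φ η) :=
  integrable_of_hasSum (integrable_pow_div_mul_hat_pow hφ h1 a)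
    (summable_integral_norm_hat_pow hφ h1 ha) (hasSum_neg_log hφ h1 ha)

/-- `logDensity` is the series of convolution powers `∑ aⁿ φ^{*n} / n`. -/
theorem hasSum_logDensity {φ : 𝓢(ℝ, ℝ)} (hφ : ∀ x, 0 ≤ φ x) (h1 : ∫ x, φ x = 1) {a : ℂ}
    (ha : ‖a‖ < 1) (y : ℝ) :
    HasSum (fun n : ℕ => a ^ n / (n : ℂ) * convPow (toComplex φ) (n - 1) y)
      (logDensity φ a y) := by
  have hexp : Continuous fun η : ℝ => Complex.exp (Complex.I * ((y * η : ℝ) : ℂ)) := by fun_prop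
  have h := hasSum_integral_of_summable_integral_norm (μ := volume)
    (F := fun (n : ℕ) (η : ℝ) => Complex.exp (Complex.I * ((y * η : ℝ) : ℂ)) *
      (a ^ n / (n : ℂ) * hat φ η ^ n))
    (fun n => (integrable_pow_div_mul_hat_pow hφ h1 a n).bdd_mul hexp.aestronglyMeasurable
      (Filter.Eventually.of_forall fun η => (norm_exp_I_mul_ofReal _).le))
    (by
      simp_rw [fun (η : ℝ) (z : ℂ) => norm_mul (Complex.exp (Complex.I * ((y * η : ℝ) : ℂ))) z,
        norm_exp_I_mul_ofReal, one_mul]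
      exact summable_integral_norm_hat_pow hφ h1 ha)
  simp_rw [tsum_mul_left, (hasSum_neg_log hφ h1 ha _).tsum_eq] at h
  refine (h.mul_left (((2 * Real.pi)⁻¹ : ℝ) : ℂ)).congr_fun ?_
  intro n
  -- At `n = 0` the coefficient `a ^ 0 / 0` is zero, so the truncated index `n - 1` does no harm.
  rcases n with _ | n
  · simp
  · rw [Nat.add_sub_cancel, ← inverse_hat_pow]
    simp_rw [mul_left_comm (Complex.exp _), integral_const_mul]
    ring

theorem summable_integral_norm_convPow {φ : 𝓢(ℝ, ℝ)} (hφ : ∀ x, 0 ≤ φ x) (h1 : ∫ x, φ x = 1) {a : ℂ}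
    (ha : ‖a‖ < 1) :
    Summable fun n : ℕ => ∫ y, ‖a ^ n / (n : ℂ) * convPow (toComplex φ) (n - 1) y‖ := by
  simp_rw [norm_mul, integral_const_mul, integral_norm_convPow hφ h1, mul_one]
  simpa using summable_pow_div ha

theorem integrable_logDensity {φ : 𝓢(ℝ, ℝ)} (hφ : ∀ x, 0 ≤ φ x) (h1 : ∫ x, φ x = 1) {a : ℂ}
    (ha : ‖a‖ < 1) : Integrable (logDensity φ a) :=
  integrable_of_hasSum (fun _ => (SchwartzMap.integrable _).const_mul _)
    (summable_integral_norm_convPow hφ h1 ha) (hasSum_logDensity hφ h1 ha)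

/-! ### Series of measures represented by complex densities -/

section Represents

variable {E E' B B' : Type*} [MeasurableSpace E] [MeasurableSpace E'] [MeasurableSpace B]
  [MeasurableSpace B']

/-- The series `∑ aⁿ m_n` of finite measures converges absolutely, and its sum is the image under
`T` of the complex measure with density `g` with respect to `β`. -/
structure Represents (a : ℂ) (m : ℕ → FiniteMeasure E) (β : Measure B) (g : B → ℂ) (T : B → E) :
    Prop where
  summable : Summable fun n => ‖a‖ ^ n * ((m n).mass : ℝ)
  measurable_density : Measurable g
  integrable_density : Integrable g β
  measurable_map : Measurable T
  hasSum : ∀ F : E → ℂ, Measurable F → ∀ K : ℝ, (∀ e, ‖F e‖ ≤ K) →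
    HasSum (fun n => a ^ n * ∫ e, F e ∂(m n : Measure E)) (∫ x, F (T x) * g x ∂β)

theorem norm_integral_le_mass (m : FiniteMeasure E) {F : E → ℂ} {K : ℝ} (hK : ∀ e, ‖F e‖ ≤ K) :
    ‖∫ e, F e ∂(m : Measure E)‖ ≤ K * m.mass :=
  norm_integral_le_of_norm_le_const (Filter.Eventually.of_forall hK)

theorem integrable_of_norm_le {m : Measure E} [IsFiniteMeasure m] {F : E → ℂ} (hF : Measurable F)
    {K : ℝ} (hK : ∀ e, ‖F e‖ ≤ K) : Integrable F m :=
  Integrable.of_bound hF.aestronglyMeasurable K (Filter.Eventually.of_forall hK)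

theorem norm_integral_prod_le_mass (m : FiniteMeasure E) (m' : FiniteMeasure E')
    {H : E × E' → ℂ} {K : ℝ} (hK : ∀ e, ‖H e‖ ≤ K) :
    ‖∫ e, H e ∂((m : Measure E).prod (m' : Measure E'))‖ ≤ K * (m.mass * m'.mass) := by
  refine (norm_integral_le_of_norm_le_const (Filter.Eventually.of_forall hK)).trans_eq ?_
  rw [measureReal_def, ← Set.univ_prod_univ, Measure.prod_prod, ENNReal.toReal_mul]
  rfl

/-- Double series of integrals against products of represented families of measures. -/
theorem Represents.hasSum_prod {a b : ℂ} {m : ℕ → FiniteMeasure E} {m' : ℕ → FiniteMeasure E'}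
    {β : Measure B} {β' : Measure B'} [SFinite β] [SFinite β'] {g : B → ℂ} {g' : B' → ℂ}
    {T : B → E} {T' : B' → E'} (h : Represents a m β g T) (h' : Represents b m' β' g' T')
    {H : E × E' → ℂ} (hH : Measurable H) {K : ℝ} (hK : ∀ e, ‖H e‖ ≤ K) :
    HasSum (fun pq : ℕ × ℕ => a ^ pq.1 * b ^ pq.2 *
        ∫ e, H e ∂((m pq.1 : Measure E).prod (m' pq.2 : Measure E')))
      (∫ x, H (T x.1, T' x.2) * (g x.1 * g' x.2) ∂(β.prod β')) := by
  have hg := h.measurable_density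
  have hg' := h'.measurable_density
  have hT := h.measurable_map
  have hT' := h'.measurable_map
  have hsum : Summable (fun pq : ℕ × ℕ => a ^ pq.1 * b ^ pq.2 *
      ∫ e, H e ∂((m pq.1 : Measure E).prod (m' pq.2 : Measure E'))) := by
    have h0 := (h.summable.mul_of_nonneg h'.summable (fun n => by positivity)
      (fun n => by positivity)).mul_left K
    refine Summable.of_norm_bounded h0 fun pq => ?_
    rw [norm_mul, norm_mul, norm_pow, norm_pow]
    calc ‖a‖ ^ pq.1 * ‖b‖ ^ pq.2 * _ ≤ ‖a‖ ^ pq.1 * ‖b‖ ^ pq.2 *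
          (K * ((m pq.1).mass * (m' pq.2).mass)) := by
            gcongr; exact norm_integral_prod_le_mass _ _ hK
      _ = _ := by ring
  -- The second family is summed out first; the result `k` is again a bounded measurable test
  -- function, to which the representation of the first family applies.
  set k : E → ℂ := fun e => ∫ x, H (e, T' x) * g' x ∂β' with hk
  have hkm : Measurable k := by
    have : Measurable fun p : E × B' => H (p.1, T' p.2) * g' p.2 := by fun_prop
    exact this.stronglyMeasurable.integral_prod_right'.measurable
  have hkb (e : E) : ‖k e‖ ≤ K * ∫ x, ‖g' x‖ ∂β' := by
    rw [← integral_const_mul]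
    refine norm_integral_le_of_norm_le (h'.integrable_density.norm.const_mul K)
      (Filter.Eventually.of_forall fun x => ?_)
    rw [norm_mul]
    exact mul_le_mul_of_nonneg_right (hK _) (norm_nonneg _)
  have hfib (p : ℕ) : HasSum (fun q : ℕ => a ^ p * b ^ q *
      ∫ e, H e ∂((m p : Measure E).prod (m' q : Measure E')))
      (a ^ p * ∫ e, k e ∂(m p : Measure E)) := by
    have hin (q : ℕ) : Measurable fun e : E => ∫ e', H (e, e') ∂(m' q : Measure E') :=
      hH.stronglyMeasurable.integral_prod_right'.measurable
    have hbd (q : ℕ) (e : E) : ‖b ^ q * ∫ e', H (e, e') ∂(m' q : Measure E')‖ ≤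
        K * (‖b‖ ^ q * (m' q).mass) := by
      rw [norm_mul, norm_pow]
      calc _ ≤ ‖b‖ ^ q * (K * (m' q).mass) := by
            gcongr; exact norm_integral_le_mass _ fun e' => hK _
        _ = _ := by ring
    have hsi := hasSum_integral_of_summable_integral_norm (μ := (m p : Measure E))
      (F := fun (q : ℕ) (e : E) => b ^ q * ∫ e', H (e, e') ∂(m' q : Measure E'))
      (fun q => integrable_of_norm_le ((hin q).const_mul _) (hbd q))
      (Summable.of_nonneg_of_le (fun q => integral_nonneg fun _ => norm_nonneg _)
        (fun q => (integral_mono_of_nonneg (Filter.Eventually.of_forall fun _ => norm_nonneg _)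
          (integrable_const _) (Filter.Eventually.of_forall (hbd q))).trans_eq (integral_const _))
        ((h'.summable.mul_left K).mul_left _))
    have htsum (e : E) : ∑' q, b ^ q * ∫ e', H (e, e') ∂(m' q : Measure E') = k e :=
      (h'.hasSum (fun e' => H (e, e')) (by fun_prop) K fun e' => hK _).tsum_eq
    simp_rw [htsum] at hsi
    refine (hsi.mul_left (a ^ p)).congr_fun fun q => ?_
    rw [integral_prod _ (integrable_of_norm_le hH hK), integral_const_mul, mul_assoc]
  have hval : ∫ x, k (T x) * g x ∂β =
      ∫ x, H (T x.1, T' x.2) * (g x.1 * g' x.2) ∂(β.prod β') := by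
    rw [integral_prod]
    · refine integral_congr_ae (Filter.Eventually.of_forall fun x => ?_)
      simp only [hk]
      rw [← integral_mul_const]
      refine integral_congr_ae (Filter.Eventually.of_forall fun y => ?_)
      simp only
      ring
    · refine (h.integrable_density.mul_prod h'.integrable_density).bdd_mul (c := K) ?_
        (Filter.Eventually.of_forall fun x => hK _)
      exact (show Measurable fun x : B × B' => H (T x.1, T' x.2) by fun_prop).aestronglyMeasurable
  have h1 := hsum.hasSum.prod_fiberwise hfib
  -- The double sum and the right-hand integral are both sums of `a ^ p * ∫ k` over `p`.
  rw [← hval, ← h1.unique (h.hasSum k hkm _ hkb)]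
  exact hsum.hasSum

end Represents

section Represents

variable {E B B' : Type*} [MeasurableSpace E] [MeasurableSpace B] [MeasurableSpace B']

theorem integral_finset_sum_finiteMeasure {ι : Type*} (s : Finset ι) (m : ι → FiniteMeasure E)
    {F : E → ℂ} (hF : Measurable F) {K : ℝ} (hK : ∀ e, ‖F e‖ ≤ K) :
    ∫ e, F e ∂((∑ i ∈ s, m i : FiniteMeasure E) : Measure E) =
      ∑ i ∈ s, ∫ e, F e ∂(m i : Measure E) := by
  rw [FiniteMeasure.toMeasure_sum]
  exact integral_finsetSum_measure fun i _ => integrable_of_norm_le hF hK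

theorem Represents.comp_equiv {a : ℂ} {m : ℕ → FiniteMeasure E} {β : Measure B} {β' : Measure B'}
    {g : B → ℂ} {T : B → E} (h : Represents a m β g T) (e : B' ≃ᵐ B)
    (he : MeasurePreserving e β' β) :
    Represents a m β' (fun x => g (e x)) (fun x => T (e x)) where
  summable := h.summable
  measurable_density := h.measurable_density.comp e.measurable
  integrable_density := he.integrable_comp_of_integrable h.integrable_density
  measurable_map := h.measurable_map.comp e.measurable
  hasSum F hF K hK := by
    rw [he.integral_comp' (fun x => F (T x) * g x)]
    exact h.hasSum F hF K hK

end Represents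

/-! ### Total mass and convolution powers of represented series -/

section Mass

variable {E : Type*} [AddCommMonoid E] [MeasurableSpace E] [MeasurableAdd₂ E]

theorem mass_mul (m n : FiniteMeasure E) : (m * n).mass = m.mass * n.mass := by
  rw [← ENNReal.coe_inj, ENNReal.coe_mul, FiniteMeasure.ennreal_mass, FiniteMeasure.ennreal_mass,
    FiniteMeasure.ennreal_mass, toMeasure_mul, Measure.conv,
    Measure.map_apply (by fun_prop) MeasurableSet.univ, Set.preimage_univ, ← Set.univ_prod_univ,
    Measure.prod_prod]

theorem mass_one : (1 : FiniteMeasure E).mass = 1 := by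
  rw [← ENNReal.coe_inj, FiniteMeasure.ennreal_mass, toMeasure_one]
  simp

/-- The total mass as a homomorphism of semirings. -/
noncomputable def massHom : FiniteMeasure E →+* NNReal where
  toFun := FiniteMeasure.mass
  map_one' := mass_one
  map_mul' := mass_mul
  map_zero' := FiniteMeasure.zero_mass
  map_add' m n := congrFun (FiniteMeasure.coeFn_add m n) Set.univ

theorem massHom_apply (m : FiniteMeasure E) : massHom m = m.mass := rfl

end Mass

section Convolution

variable {E B B' : Type*} [AddCommMonoid E] [MeasurableSpace E] [MeasurableAdd₂ E]
  [MeasurableSpace B] [MeasurableSpace B']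

theorem integral_mul_finiteMeasure (m n : FiniteMeasure E) {F : E → ℂ} (hF : Measurable F) :
    ∫ e, F e ∂((m * n : FiniteMeasure E) : Measure E) =
      ∫ e, F (e.1 + e.2) ∂((m : Measure E).prod (n : Measure E)) := by
  rw [toMeasure_mul, Measure.conv, integral_map (by fun_prop) hF.aestronglyMeasurable]

/-- The Cauchy product of represented series of measures is represented by the product density. -/
theorem Represents.mul {a : ℂ} {f f' : PowerSeries (FiniteMeasure E)}
    {β : Measure B} {β' : Measure B'} [SFinite β] [SFinite β'] {g : B → ℂ} {g' : B' → ℂ}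
    {T : B → E} {T' : B' → E} (h : Represents a (fun n => PowerSeries.coeff n f) β g T)
    (h' : Represents a (fun n => PowerSeries.coeff n f') β' g' T') :
    Represents a (fun n => PowerSeries.coeff n (f * f')) (β.prod β')
      (fun x => g x.1 * g' x.2) (fun x => T x.1 + T' x.2) where
  summable := by
    have h0 := summable_sum_mul_antidiagonal_of_summable_mul
      (f := fun n => ‖a‖ ^ n * ((PowerSeries.coeff n f).mass : ℝ))
      (g := fun n => ‖a‖ ^ n * ((PowerSeries.coeff n f').mass : ℝ))
      (h.summable.mul_of_nonneg h'.summable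
        (fun n => mul_nonneg (pow_nonneg (norm_nonneg a) n) NNReal.zero_le_coe)
        (fun n => mul_nonneg (pow_nonneg (norm_nonneg a) n) NNReal.zero_le_coe))
    refine h0.congr fun n => ?_
    rw [PowerSeries.coeff_mul, ← massHom_apply, map_sum, NNReal.coe_sum, Finset.mul_sum]
    refine Finset.sum_congr rfl fun kl hkl => ?_
    rw [map_mul, massHom_apply, massHom_apply, ← Finset.HasAntidiagonal.mem_antidiagonal.1 hkl,
      pow_add, NNReal.coe_mul]
    ring
  measurable_density := by
    have := h.measurable_density
    have := h'.measurable_density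
    fun_prop
  integrable_density := h.integrable_density.mul_prod h'.integrable_density
  measurable_map := by
    have := h.measurable_map
    have := h'.measurable_map
    fun_prop
  hasSum := by
    intro F hF K hK
    have h0 := h.hasSum_prod h' (H := fun e => F (e.1 + e.2)) (by fun_prop) (fun e => hK _)
    have h1 := (Finset.HasAntidiagonal.sigmaAntidiagonalEquivProd.hasSum_iff).2 h0
    refine (h1.sigma fun n => hasSum_fintype _).congr_fun fun n => ?_
    rw [PowerSeries.coeff_mul, integral_finset_sum_finiteMeasure _ _ hF hK, Finset.mul_sum,
      ← Finset.sum_coe_sort]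
    refine Finset.sum_congr rfl fun kl _ => ?_
    rw [integral_mul_finiteMeasure _ _ hF]
    simp only [Function.comp_apply, Finset.HasAntidiagonal.sigmaAntidiagonalEquivProd_apply]
    rw [← pow_add, Finset.HasAntidiagonal.mem_antidiagonal.1 kl.2]

theorem represents_one (a : ℂ) :
    Represents a (fun n => PowerSeries.coeff n (1 : PowerSeries (FiniteMeasure E)))
      (volume : Measure (Fin 0 → ℝ)) (fun _ => 1) (fun _ => 0) where
  summable := summable_of_ne_finset_zero (s := {0}) fun n hn => by
    rw [PowerSeries.coeff_one, if_neg (by simpa using hn)]; simp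
  measurable_density := measurable_const
  integrable_density := integrable_const _
  measurable_map := measurable_const
  hasSum F hF K hK := by
    have := hasSum_single (f := fun n => a ^ n * ∫ e, F e
      ∂((PowerSeries.coeff n (1 : PowerSeries (FiniteMeasure E)) : FiniteMeasure E) :
        Measure E)) 0
      (fun n hn => by rw [PowerSeries.coeff_one, if_neg hn]; simp)
    convert this using 1
    have hv : (volume : Measure (Fin 0 → ℝ)).real Set.univ = 1 := by
      simp [measureReal_def, volume_pi]
    simp [toMeasure_one, integral_dirac' _ _ hF.stronglyMeasurable, hv]

/-- Powers of a represented series are represented by tensor powers of the density. -/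
theorem Represents.pow {a : ℂ} {f : PowerSeries (FiniteMeasure E)} {g : ℝ → ℂ} {T : ℝ → E}
    (h : Represents a (fun n => PowerSeries.coeff n f) volume g T) (j : ℕ) :
    Represents a (fun n => PowerSeries.coeff n (f ^ j)) (volume : Measure (Fin j → ℝ))
      (fun y => ∏ i, g (y i)) (fun y => ∑ i, T (y i)) := by
  induction j with
  | zero => simpa using represents_one a
  | succ j ih =>
    have h1 := (h.mul ih).comp_equiv (MeasurableEquiv.piFinSuccAbove (fun _ => ℝ) 0)
      (volume_preserving_piFinSuccAbove (fun _ => ℝ) 0)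
    simp_rw [pow_succ', Fin.prod_univ_succ, Fin.sum_univ_succ]
    exact h1

end Convolution

/-! ### The logarithmic series of the step law -/

theorem measurable_logDensity (φ : 𝓢(ℝ, ℝ)) (a : ℂ) : Measurable (logDensity φ a) := by
  have hh := (continuous_hat φ).measurable
  have h1 : Measurable fun p : ℝ × ℝ => Complex.exp (Complex.I * ((p.1 * p.2 : ℝ) : ℂ)) *
    -Complex.log (1 - a * hat φ p.2) := by fun_prop
  exact h1.stronglyMeasurable.integral_prod_right'.measurable.const_mul _

section StepLaw

variable {φ : 𝓢(ℝ, ℝ)} {ν : FiniteMeasure (ℝ × ℝ)}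

theorem integral_stepLaw (hφ : ∀ x, 0 ≤ φ x)
    (hν : (ν : Measure (ℝ × ℝ)) =
      (volume.withDensity fun x => ENNReal.ofReal (φ x)).map fun x => (x, x))
    {F : ℝ × ℝ → ℂ} (hF : Measurable F) :
    ∫ e, F e ∂(ν : Measure (ℝ × ℝ)) = ∫ x, toComplex φ x * F (x, x) := by
  have hm : Measurable fun x : ℝ => ENNReal.ofReal (φ x) :=
    φ.continuous.measurable.ennreal_ofReal
  rw [hν, integral_map (by fun_prop) hF.aestronglyMeasurable,
    integral_withDensity_eq_integral_toReal_smul hm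
      (Filter.Eventually.of_forall fun _ => ENNReal.ofReal_lt_top)]
  refine integral_congr_ae (Filter.Eventually.of_forall fun x => ?_)
  simp [ENNReal.toReal_ofReal (hφ x)]

/-- The law of the position after `n + 1` steps has the `(n+1)`-fold convolution power as
density. -/
theorem integral_stepLaw_pow (hφ : ∀ x, 0 ≤ φ x)
    (hν : (ν : Measure (ℝ × ℝ)) =
      (volume.withDensity fun x => ENNReal.ofReal (φ x)).map fun x => (x, x)) (n : ℕ) :
    ∀ {F : ℝ × ℝ → ℂ}, Measurable F → ∀ {K : ℝ}, (∀ e, ‖F e‖ ≤ K) →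
    ∫ e, F e ∂((ν ^ (n + 1) : FiniteMeasure (ℝ × ℝ)) : Measure (ℝ × ℝ)) =
      ∫ x, F (x, x) * convPow (toComplex φ) n x := by
  induction n with
  | zero =>
    intro F hF K hK
    rw [zero_add, pow_one, integral_stepLaw hφ hν hF]
    simp_rw [mul_comm]
    rfl
  | succ n ih =>
    intro F hF K hK
    have hG : Measurable fun e : (ℝ × ℝ) × (ℝ × ℝ) => F (e.1 + e.2) := by fun_prop
    rw [pow_succ' ν, integral_mul_finiteMeasure _ _ hF,
      integral_prod _ (integrable_of_norm_le hG fun e => hK _),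
      integral_stepLaw hφ hν hG.stronglyMeasurable.integral_prod_right'.measurable,
      integral_mul_convPow_succ (toComplex φ) n (F := fun x => F (x, x)) (by fun_prop)
        fun x => hK _]
    refine integral_congr_ae (Filter.Eventually.of_forall fun t => ?_)
    simp only
    rw [ih (F := fun e => F ((t, t) + e)) (by fun_prop) fun e => hK _]
    rfl

theorem mass_posPush (m : FiniteMeasure (ℝ × ℝ)) : (posPush m).mass = m.mass := by
  rw [← ENNReal.coe_inj, FiniteMeasure.ennreal_mass, FiniteMeasure.ennreal_mass, toMeasure_posPush,
    Measure.map_apply measurable_posPart MeasurableSet.univ, Set.preimage_univ]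

/-- The bridge between probability and Fourier analysis: `ν ^ n` lives on the diagonal with density
`φ^{*n}`, so `P` moves it to the curve `(y, y⁺)`. The weighted sum of these densities is
`logDensity`. -/
theorem represents_logSeries (hφ : ∀ x, 0 ≤ φ x) (h1 : ∫ x, φ x = 1)
    (hν : (ν : Measure (ℝ × ℝ)) =
      (volume.withDensity fun x => ENNReal.ofReal (φ x)).map fun x => (x, x))
    (hmass : ν.mass = 1) {a : ℂ} (ha : ‖a‖ < 1) :
    Represents a (fun n => PowerSeries.coeff n (logSeries ν)) volume (logDensity φ a)
      (fun y => (y, max 0 y)) where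
  summable := by
    refine (summable_pow_div ha).congr fun n => ?_
    have : ((n : NNReal)⁻¹ • posPush (ν ^ n)).mass = (n : NNReal)⁻¹ := by
      have h2 : (ν ^ n).mass = 1 := by rw [← massHom_apply, map_pow, massHom_apply, hmass, one_pow]
      have h3 : ((n : NNReal)⁻¹ • posPush (ν ^ n)).mass =
          (n : NNReal)⁻¹ * (posPush (ν ^ n)).mass :=
        congrFun (FiniteMeasure.coeFn_smul _ _) Set.univ
      rw [h3, mass_posPush, h2, mul_one]
    rw [logSeries, PowerSeries.coeff_mk, this, norm_div, norm_pow]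
    simp [div_eq_mul_inv]
  measurable_density := measurable_logDensity φ a
  integrable_density := integrable_logDensity hφ h1 ha
  measurable_map := by fun_prop
  hasSum F hF K hK := by
    have hF' : Measurable fun y : ℝ => F (y, max 0 y) := by fun_prop
    have hs := hasSum_integral_of_summable_integral_norm (μ := volume)
      (F := fun (n : ℕ) (y : ℝ) => F (y, max 0 y) *
        (a ^ n / (n : ℂ) * convPow (toComplex φ) (n - 1) y))
      (fun n => ((SchwartzMap.integrable _).const_mul _).bdd_mul hF'.aestronglyMeasurable
        (Filter.Eventually.of_forall fun y => hK _))
      (by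
        refine Summable.of_nonneg_of_le (fun n => integral_nonneg fun _ => norm_nonneg _)
          (fun n => ?_) ((summable_integral_norm_convPow hφ h1 ha).mul_left K)
        rw [← integral_const_mul]
        refine integral_mono_of_nonneg (Filter.Eventually.of_forall fun _ => norm_nonneg _)
          (((SchwartzMap.integrable _).const_mul _).norm.const_mul _)
          (Filter.Eventually.of_forall fun y => ?_)
        simp only [norm_mul (F _)]
        exact mul_le_mul_of_nonneg_right (hK _) (norm_nonneg _))
    simp_rw [tsum_mul_left, (hasSum_logDensity hφ h1 ha _).tsum_eq] at hs
    refine hs.congr_fun fun n => ?_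
    rw [logSeries, PowerSeries.coeff_mk, FiniteMeasure.toMeasure_smul, integral_smul_nnreal_measure,
      toMeasure_posPush, integral_map (by fun_prop) hF.aestronglyMeasurable]
    rcases n with _ | n
    · simp
    · rw [integral_stepLaw_pow hφ hν n (F := fun e => F (posPart e)) (by fun_prop) fun e => hK _,
        Nat.add_sub_cancel]
      simp_rw [mul_left_comm (F _), integral_const_mul]
      simp only [posPart, NNReal.smul_def, Complex.real_smul]
      push_cast
      ring

end StepLaw

/-! ### The symbol as a tensor product -/

section Symbol

variable {φ : 𝓢(ℝ, ℝ)} {a b : ℂ} {j k : ℕ}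

theorem symbol_eq (hφ : ∀ x, 0 ≤ φ x) (h1 : ∫ x, φ x = 1) (ha : ‖a‖ < 1) (hb : ‖b‖ < 1)
    (hj : 1 ≤ j) (hk : 1 ≤ k) :
    symbol φ a b j k = fun v => (∏ i, -Complex.log (1 - a * hat φ (v.1 i))) *
      ∏ i, -Complex.log (1 - b * hat φ (v.2 i)) := by
  funext v
  rw [symbol, Phi, Phi,
    (hasSum_Phi_geom a hj fun i => (norm_mul_hat_le hφ h1 a (v.1 i)).trans_lt ha).tsum_eq,
    (hasSum_Phi_geom b hk fun i => (norm_mul_hat_le hφ h1 b (v.2 i)).trans_lt hb).tsum_eq]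

theorem integrable_symbol (hφ : ∀ x, 0 ≤ φ x) (h1 : ∫ x, φ x = 1) (ha : ‖a‖ < 1) (hb : ‖b‖ < 1)
    (hj : 1 ≤ j) (hk : 1 ≤ k) : Integrable (symbol φ a b j k) := by
  rw [symbol_eq hφ h1 ha hb hj hk]
  exact (Integrable.fintype_prod (f := fun (_ : Fin j) η => -Complex.log (1 - a * hat φ η))
    fun _ => integrable_neg_log_hat hφ h1 ha).mul_prod
    (Integrable.fintype_prod (f := fun (_ : Fin k) η => -Complex.log (1 - b * hat φ η))
      fun _ => integrable_neg_log_hat hφ h1 hb)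

theorem prod_logDensity (φ : ℝ → ℝ) (a : ℂ) (y : Fin j → ℝ) :
    ∏ i, logDensity φ a (y i) = (((2 * Real.pi)⁻¹ : ℝ) : ℂ) ^ j *
      ∫ η : Fin j → ℝ, ∏ i, (Complex.exp (Complex.I * ((y i * η i : ℝ) : ℂ)) *
        -Complex.log (1 - a * hat φ (η i))) := by
  simp_rw [logDensity]
  rw [Finset.prod_mul_distrib, Finset.prod_const, Finset.card_univ, Fintype.card_fin,
    integral_fintype_prod_volume_eq_prod (fun i (η : ℝ) =>
      Complex.exp (Complex.I * ((y i * η : ℝ) : ℂ)) * -Complex.log (1 - a * hat φ η))]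

/-- The symbol and the exponential kernel both factor over coordinates, so Fubini reduces the
transform to one-dimensional ones. -/
theorem invFourier_symbol (hφ : ∀ x, 0 ≤ φ x) (h1 : ∫ x, φ x = 1) (ha : ‖a‖ < 1) (hb : ‖b‖ < 1)
    (hj : 1 ≤ j) (hk : 1 ≤ k) (y : Fin j → ℝ) (z : Fin k → ℝ) :
    invFourier (symbol φ a b j k) y z =
      (∏ i, logDensity φ a (y i)) * ∏ i, logDensity φ b (z i) := by
  rw [invFourier, symbol_eq hφ h1 ha hb hj hk, prod_logDensity, prod_logDensity, mul_mul_mul_comm,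
    ← integral_prod_mul, ← pow_add]
  congr 1
  · push_cast; rw [inv_pow]
  · refine integral_congr_ae (Filter.Eventually.of_forall fun v => ?_)
    simp only [Finset.prod_mul_distrib, ← Complex.exp_sum]
    rw [mul_mul_mul_comm, ← Complex.exp_add]
    congr 2
    push_cast
    rw [mul_add, Finset.mul_sum, Finset.mul_sum]

end Symbol

/-! ### The test function and the expectation -/

/-- The test function `exp (iαs + iβ max(t, s + t'))` on pairs of states `(s, t)`, `(s', t')`. -/
noncomputable def testFun (α β : ℝ) (e : (ℝ × ℝ) × (ℝ × ℝ)) : ℂ :=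
  Complex.exp (Complex.I *
    ((α * e.1.1 + β * (e.1.2 + max 0 (e.1.1 - e.1.2 + e.2.2)) : ℝ) : ℂ))

@[fun_prop]
theorem measurable_testFun (α β : ℝ) : Measurable (testFun α β) := by
  unfold testFun; fun_prop

theorem norm_testFun_le (α β : ℝ) (e : (ℝ × ℝ) × (ℝ × ℝ)) : ‖testFun α β e‖ ≤ 1 :=
  (norm_exp_I_mul_ofReal _).le

/-- The origin of `Ω_{j,k}`: since `y - y⁺ = min 0 y`, the difference between position and maximum
contributes exactly the negative parts. -/
theorem testFun_sum (α β : ℝ) {j k : ℕ} (y : Fin j → ℝ) (z : Fin k → ℝ) :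
    testFun α β (∑ i, (y i, max 0 (y i)), ∑ i, (z i, max 0 (z i))) =
      Complex.exp (Complex.I * ((α * ∑ i, y i + β * weight y z : ℝ) : ℂ)) := by
  have : ∑ i, y i - ∑ i, max 0 (y i) = ∑ i, min 0 (y i) := by
    rw [← Finset.sum_sub_distrib]
    refine Finset.sum_congr rfl fun i _ => ?_
    have := min_add_max 0 (y i)
    linarith
  simp only [testFun, weight, Prod.fst_sum, Prod.snd_sum, this]

theorem integrand_eq {φ : 𝓢(ℝ, ℝ)} (hφ : ∀ x, 0 ≤ φ x) (h1 : ∫ x, φ x = 1) {a b : ℂ} (ha : ‖a‖ < 1)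
    (hb : ‖b‖ < 1) (α β : ℝ) {j k : ℕ} (hj : 1 ≤ j) (hk : 1 ≤ k) :
    integrand φ a b α β j k = fun w =>
      testFun α β (∑ i, (w.1 i, max 0 (w.1 i)), ∑ i, (w.2 i, max 0 (w.2 i))) *
        ((∏ i, logDensity φ a (w.1 i)) * ∏ i, logDensity φ b (w.2 i)) := by
  funext w
  rw [integrand, invFourier_symbol hφ h1 ha hb hj hk, testFun_sum]

theorem integrable_integrand {φ : 𝓢(ℝ, ℝ)} (hφ : ∀ x, 0 ≤ φ x) (h1 : ∫ x, φ x = 1) {a b : ℂ}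
    (ha : ‖a‖ < 1) (hb : ‖b‖ < 1) (α β : ℝ) {j k : ℕ} (hj : 1 ≤ j) (hk : 1 ≤ k) :
    Integrable (integrand φ a b α β j k) := by
  rw [integrand_eq hφ h1 ha hb α β hj hk]
  have h := (Integrable.fintype_prod (f := fun (_ : Fin j) => logDensity φ a)
    fun _ => integrable_logDensity hφ h1 ha).mul_prod
    (Integrable.fintype_prod (f := fun (_ : Fin k) => logDensity φ b)
      fun _ => integrable_logDensity hφ h1 hb)
  refine h.bdd_mul (c := 1) ?_ (Filter.Eventually.of_forall fun _ => norm_testFun_le _ _ _)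
  exact (show Measurable fun w : (Fin j → ℝ) × (Fin k → ℝ) =>
    testFun α β (∑ i, (w.1 i, max 0 (w.1 i)), ∑ i, (w.2 i, max 0 (w.2 i))) by
      fun_prop).aestronglyMeasurable

/-- Independence of the two blocks makes the joint law a product, and `runningMax_add` expresses the
overall maximum through the two states. -/
theorem integral_walk_eq {Ω : Type*} [MeasurableSpace Ω] {μ : Measure Ω} [IsProbabilityMeasure μ]
    {ν : FiniteMeasure (ℝ × ℝ)} {X : ℕ → Ω → ℝ} (hX : ∀ i, AEMeasurable (X i) μ)
    (hindep : iIndepFun X μ) (hν : ∀ i, μ.map (fun ω => (X i ω, X i ω)) = ν) (α β : ℝ) (p q : ℕ) :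
    ∫ ω, Complex.exp (Complex.I * ((α * position X p ω + β * runningMax X (p + q) ω : ℝ) : ℂ)) ∂μ =
      ∫ e, testFun α β e ∂((walkLaw ν p : Measure (ℝ × ℝ)).prod (walkLaw ν q)) := by
  have hX' : ∀ i, AEMeasurable (X (p + i)) μ := fun i => hX _
  have hm := aemeasurable_walkState hX p
  have hm' := aemeasurable_walkState hX' q
  rw [← map_walkState p hX hindep hν,
    ← map_walkState q hX' (hindep.precomp (add_right_injective p)) fun i => hν _,
    ← (indepFun_iff_map_prod_eq_prod_map_map hm hm').1 (indepFun_walkState hX hindep p q),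
    integral_map (hm.prodMk hm') (measurable_testFun α β).aestronglyMeasurable]
  refine integral_congr_ae (Filter.Eventually.of_forall fun ω => ?_)
  simp only [testFun, walkState, runningMax_add]
  congr 6
  rw [← max_add_add_left]
  congr 1 <;> ring

/-! ### Absolute summability and the two orders of summation -/

section Sums

variable {ν : FiniteMeasure (ℝ × ℝ)}

/-- `D_{j,p}`, the `p`-th coefficient of the `j`-th power of the logarithmic series. -/
noncomputable def logPow (ν : FiniteMeasure (ℝ × ℝ)) (j p : ℕ) : FiniteMeasure (ℝ × ℝ) :=
  PowerSeries.coeff p (logSeries ν ^ j)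

theorem coeff_zero_logSeries (ν : FiniteMeasure (ℝ × ℝ)) :
    PowerSeries.coeff 0 (logSeries ν) = 0 := by
  simp [logSeries]

theorem logPow_of_lt {j p : ℕ} (h : p < j) : logPow ν j p = 0 :=
  coeff_pow_of_lt (coeff_zero_logSeries ν) h

theorem logPow_zero_left {p : ℕ} (h : p ≠ 0) : logPow ν 0 p = 0 := by
  simp [logPow, PowerSeries.coeff_one, h]

theorem walkLaw_eq_sum (ν : FiniteMeasure (ℝ × ℝ)) (p : ℕ) :
    walkLaw ν p = ∑ j ∈ Finset.range (p + 1), (j.factorial : NNReal)⁻¹ • logPow ν j p :=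
  walkLaw_eq_expCoeff ν p

theorem integral_sum_smul {E : Type*} [MeasurableSpace E] (s : Finset ℕ) (m : ℕ → FiniteMeasure E)
    {F : E → ℂ} (hF : Measurable F) {K : ℝ} (hK : ∀ e, ‖F e‖ ≤ K) :
    ∫ e, F e ∂((∑ j ∈ s, (j.factorial : NNReal)⁻¹ • m j : FiniteMeasure E) : Measure E) =
      ∑ j ∈ s, 1 / (j.factorial : ℂ) * ∫ e, F e ∂(m j : Measure E) := by
  rw [integral_finset_sum_finiteMeasure _ _ hF hK]
  refine Finset.sum_congr rfl fun j _ => ?_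
  rw [FiniteMeasure.toMeasure_smul, integral_smul_nnreal_measure, NNReal.smul_def,
    Complex.real_smul]
  simp

theorem integral_walkLaw_prod (ν : FiniteMeasure (ℝ × ℝ)) {H : (ℝ × ℝ) × (ℝ × ℝ) → ℂ}
    (hH : Measurable H) {K : ℝ} (hK : ∀ e, ‖H e‖ ≤ K) (p q : ℕ) :
    ∫ e, H e ∂((walkLaw ν p : Measure (ℝ × ℝ)).prod (walkLaw ν q)) =
      ∑ jk ∈ Finset.range (p + 1) ×ˢ Finset.range (q + 1),
        (1 / (jk.1.factorial : ℂ)) * (1 / (jk.2.factorial : ℂ)) *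
          ∫ e, H e ∂((logPow ν jk.1 p : Measure (ℝ × ℝ)).prod (logPow ν jk.2 q)) := by
  have hin (m : FiniteMeasure (ℝ × ℝ)) :
      Measurable fun e : ℝ × ℝ => ∫ e', H (e, e') ∂(m : Measure (ℝ × ℝ)) :=
    hH.stronglyMeasurable.integral_prod_right'.measurable
  have hbd (m : FiniteMeasure (ℝ × ℝ)) (e : ℝ × ℝ) :
      ‖∫ e', H (e, e') ∂(m : Measure (ℝ × ℝ))‖ ≤ K * m.mass :=
    norm_integral_le_mass m fun _ => hK _
  rw [Finset.sum_product, integral_prod _ (integrable_of_norm_le hH hK), walkLaw_eq_sum ν p,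
    integral_sum_smul _ _ (hin _) (hbd _)]
  refine Finset.sum_congr rfl fun j _ => ?_
  have e1 (e : ℝ × ℝ) : ∫ e', H (e, e') ∂(walkLaw ν q : Measure (ℝ × ℝ)) =
      ∑ k ∈ Finset.range (q + 1), 1 / (k.factorial : ℂ) *
        ∫ e', H (e, e') ∂(logPow ν k q : Measure (ℝ × ℝ)) := by
    rw [walkLaw_eq_sum ν q, integral_sum_smul _ _ (by fun_prop) fun _ => hK _]
  simp_rw [e1]
  rw [integral_finsetSum _ fun k _ => (integrable_of_norm_le (hin _) (hbd _)).const_mul _,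
    Finset.mul_sum]
  refine Finset.sum_congr rfl fun k _ => ?_
  rw [integral_const_mul, integral_prod _ (integrable_of_norm_le hH hK), mul_assoc]

/-- The total masses of the family `D_{j,p}` have the generating function `L ^ j`. -/
theorem hasSum_logPow_mass {φ : 𝓢(ℝ, ℝ)} (hφ : ∀ x, 0 ≤ φ x) (h1 : ∫ x, φ x = 1)
    (hν : (ν : Measure (ℝ × ℝ)) =
      (volume.withDensity fun x => ENNReal.ofReal (φ x)).map fun x => (x, x))
    (hmass : ν.mass = 1) {r : ℝ} (hr0 : 0 ≤ r) (hr : r < 1) (j : ℕ) :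
    HasSum (fun p => r ^ p * ((logPow ν j p).mass : ℝ)) (‖∫ y, logDensity φ r y‖ ^ j) := by
  have hn : ‖(r : ℂ)‖ = r := Complex.norm_of_nonneg hr0
  have hR := (represents_logSeries hφ h1 hν hmass (a := r) (hn.trans_lt hr)).pow j
  have hs := hR.summable
  rw [hn] at hs
  have h2 := hR.hasSum (fun _ => 1) measurable_const 1 fun _ => norm_one.le
  simp only [one_mul] at h2
  rw [integral_fintype_prod_volume_eq_prod (fun (_ : Fin j) => logDensity φ r),
    Finset.prod_const, Finset.card_univ, Fintype.card_fin] at h2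
  have h3 : HasSum (fun p => ((r ^ p * ((logPow ν j p).mass : ℝ) : ℝ) : ℂ))
      ((∫ y, logDensity φ r y) ^ j) := by
    refine h2.congr_fun fun p => ?_
    rw [integral_const, Complex.real_smul, mul_one, Complex.ofReal_mul, Complex.ofReal_pow]
    rfl
  have h5 : 0 ≤ ∑' p, r ^ p * ((logPow ν j p).mass : ℝ) :=
    tsum_nonneg fun p => mul_nonneg (pow_nonneg hr0 p) NNReal.zero_le_coe
  -- The integral power equals a sum of nonnegative reals, hence its own norm; this gives a real
  -- value for the sum.
  rw [← norm_pow, h3.unique (Complex.hasSum_ofReal.2 hs.hasSum)]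
  exact (Complex.norm_of_nonneg h5).symm ▸ hs.hasSum

/-- Summing over `p` first leaves the exponential series of `L`. -/
theorem summable_div_factorial_mul {u : ℕ → ℕ → ℝ} (hu : ∀ j p, 0 ≤ u j p) {L : ℝ}
    (h : ∀ j, HasSum (u j) (L ^ j)) :
    Summable fun jp : ℕ × ℕ => 1 / (jp.1.factorial : ℝ) * u jp.1 jp.2 := by
  have h0 : (0 : ℕ × ℕ → ℝ) ≤ fun jp : ℕ × ℕ => 1 / (jp.1.factorial : ℝ) * u jp.1 jp.2 :=
    fun jp => mul_nonneg (div_nonneg zero_le_one (Nat.cast_nonneg _)) (hu jp.1 jp.2)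
  have h1 : ∀ j, Summable fun p => 1 / (j.factorial : ℝ) * u j p :=
    fun j => (h j).summable.mul_left _
  have h2 : Summable fun j => ∑' p, 1 / (j.factorial : ℝ) * u j p := by
    refine (Real.summable_pow_div_factorial L).congr fun j => ?_
    rw [((h j).mul_left _).tsum_eq]
    ring
  exact (summable_prod_of_nonneg h0).2 ⟨h1, h2⟩

/-- The weighted total masses of the family `D_{j,p} / j!` are summable. -/
theorem summable_logPow_mass {φ : 𝓢(ℝ, ℝ)} (hφ : ∀ x, 0 ≤ φ x) (h1 : ∫ x, φ x = 1)
    (hν : (ν : Measure (ℝ × ℝ)) =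
      (volume.withDensity fun x => ENNReal.ofReal (φ x)).map fun x => (x, x))
    (hmass : ν.mass = 1) {r : ℝ} (hr0 : 0 ≤ r) (hr : r < 1) :
    Summable fun jp : ℕ × ℕ =>
      1 / (jp.1.factorial : ℝ) * (r ^ jp.2 * ((logPow ν jp.1 jp.2).mass : ℝ)) := by
  have hsum := hasSum_logPow_mass hφ h1 hν hmass hr0 hr
  exact summable_div_factorial_mul (u := fun j p => r ^ p * ((logPow ν j p).mass : ℝ))
    (fun _ _ => mul_nonneg (pow_nonneg hr0 _) NNReal.zero_le_coe) hsum

end Sums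

theorem pnat_prod_injective :
    Function.Injective (fun x : ℕ+ × ℕ+ => ((x.1 : ℕ), (x.2 : ℕ))) :=
  PNat.coe_injective.prodMap PNat.coe_injective

theorem hasSum_pnat_prod {f : ℕ × ℕ → ℂ} {v : ℂ} (h : HasSum f v)
    (h1 : ∀ q, f (0, q) = 0) (h2 : ∀ p, f (p, 0) = 0) :
    HasSum (fun x : ℕ+ × ℕ+ => f ((x.1 : ℕ), (x.2 : ℕ))) v := by
  refine (pnat_prod_injective.hasSum_iff ?_).2 h
  rintro ⟨p, q⟩ hpq
  rcases Nat.eq_zero_or_pos p with rfl | hp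
  · exact h1 q
  rcases Nat.eq_zero_or_pos q with rfl | hq
  · exact h2 p
  exact absurd ⟨(⟨p, hp⟩, ⟨q, hq⟩), rfl⟩ hpq


/-- The absolutely summable family which both sides of the identity sum. -/
noncomputable def spitzerTerm (ν : FiniteMeasure (ℝ × ℝ)) (a b : ℂ) (α β : ℝ) (j k p q : ℕ) : ℂ :=
  (1 / (j.factorial : ℂ)) * (1 / (k.factorial : ℂ)) * (a ^ p * b ^ q *
    ∫ e, testFun α β e ∂((logPow ν j p : Measure (ℝ × ℝ)).prod (logPow ν k q)))

theorem norm_spitzerTerm_le (ν : FiniteMeasure (ℝ × ℝ)) (a b : ℂ) (α β : ℝ) (j k p q : ℕ) :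
    ‖spitzerTerm ν a b α β j k p q‖ ≤
      (1 / (j.factorial : ℝ) * (‖a‖ ^ p * ((logPow ν j p).mass : ℝ))) *
        (1 / (k.factorial : ℝ) * (‖b‖ ^ q * ((logPow ν k q).mass : ℝ))) := by
  have hle := norm_integral_prod_le_mass (logPow ν j p) (logPow ν k q) (norm_testFun_le α β)
  generalize ((logPow ν j p).mass : ℝ) = x at hle ⊢
  generalize ((logPow ν k q).mass : ℝ) = y at hle ⊢
  rw [spitzerTerm]
  simp only [norm_mul, norm_div, norm_pow, norm_one, Complex.norm_natCast]
  calc _ ≤ 1 / (j.factorial : ℝ) * (1 / (k.factorial : ℝ)) *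
        (‖a‖ ^ p * ‖b‖ ^ q * (1 * (x * y))) := by gcongr
    _ = _ := by ring

section Walk

variable {φ : 𝓢(ℝ, ℝ)} {ν : FiniteMeasure (ℝ × ℝ)} {a b : ℂ}

/-- The bound on each term is a product of a function of `(j, p)` and one of `(k, q)`. Each factor
is summable by `summable_logPow_mass`, so it remains to regroup the indices. -/
theorem summable_spitzerTerm (hφ : ∀ x, 0 ≤ φ x) (h1 : ∫ x, φ x = 1)
    (hν : (ν : Measure (ℝ × ℝ)) =
      (volume.withDensity fun x => ENNReal.ofReal (φ x)).map fun x => (x, x))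
    (hmass : ν.mass = 1) (ha : ‖a‖ < 1) (hb : ‖b‖ < 1) (α β : ℝ) :
    Summable fun x : (ℕ+ × ℕ+) × (ℕ+ × ℕ+) =>
      spitzerTerm ν a b α β x.1.1 x.1.2 x.2.1 x.2.2 := by
  have hnn {r : ℝ} (hr : 0 ≤ r) : (0 : ℕ × ℕ → ℝ) ≤ fun jp : ℕ × ℕ =>
      1 / (jp.1.factorial : ℝ) * (r ^ jp.2 * ((logPow ν jp.1 jp.2).mass : ℝ)) := fun jp =>
    mul_nonneg (div_nonneg zero_le_one (Nat.cast_nonneg _))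
      (mul_nonneg (pow_nonneg hr _) NNReal.zero_le_coe)
  have h0 := (summable_logPow_mass hφ h1 hν hmass (norm_nonneg a) ha).mul_of_nonneg
    (summable_logPow_mass hφ h1 hν hmass (norm_nonneg b) hb)
    (hnn (norm_nonneg a)) (hnn (norm_nonneg b))
  have hinj : Function.Injective fun x : (ℕ+ × ℕ+) × (ℕ+ × ℕ+) =>
      (((x.1.1 : ℕ), (x.2.1 : ℕ)), ((x.1.2 : ℕ), (x.2.2 : ℕ))) := by
    rintro ⟨⟨j, k⟩, p, q⟩ ⟨⟨j', k'⟩, p', q'⟩ h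
    simp only [Prod.mk.injEq, PNat.coe_inj] at h ⊢
    tauto
  exact Summable.of_norm_bounded (h0.comp_injective hinj)
    fun x => norm_spitzerTerm_le ν a b α β _ _ _ _

theorem hasSum_spitzerTerm_time (hφ : ∀ x, 0 ≤ φ x) (h1 : ∫ x, φ x = 1)
    (hν : (ν : Measure (ℝ × ℝ)) =
      (volume.withDensity fun x => ENNReal.ofReal (φ x)).map fun x => (x, x))
    (hmass : ν.mass = 1) (ha : ‖a‖ < 1) (hb : ‖b‖ < 1) (α β : ℝ) {j k : ℕ} (hj : 1 ≤ j)
    (hk : 1 ≤ k) :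
    HasSum (fun pq : ℕ+ × ℕ+ => spitzerTerm ν a b α β j k pq.1 pq.2)
      ((1 / (j.factorial : ℂ)) * (1 / (k.factorial : ℂ)) * ∫ w, integrand φ a b α β j k w) := by
  rw [integrand_eq hφ h1 ha hb α β hj hk]
  have h := ((represents_logSeries hφ h1 hν hmass ha).pow j).hasSum_prod
    ((represents_logSeries hφ h1 hν hmass hb).pow k) (measurable_testFun α β) (norm_testFun_le α β)
  refine (hasSum_pnat_prod h (fun q => ?_) fun p => ?_).mul_left _
  · have : PowerSeries.coeff 0 (logSeries ν ^ j) = 0 := logPow_of_lt hj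
    simp only [this, FiniteMeasure.toMeasure_zero, Measure.zero_prod, integral_zero_measure,
      mul_zero]
  · have : PowerSeries.coeff 0 (logSeries ν ^ k) = 0 := logPow_of_lt hk
    simp only [this, FiniteMeasure.toMeasure_zero, Measure.prod_zero, integral_zero_measure,
      mul_zero]

theorem spitzerTerm_eq_zero_left (b : ℂ) (α β : ℝ) {j p : ℕ} (k q : ℕ) (h : logPow ν j p = 0) :
    spitzerTerm ν a b α β j k p q = 0 := by
  simp only [spitzerTerm, h, FiniteMeasure.toMeasure_zero, Measure.zero_prod,
    integral_zero_measure, mul_zero]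

theorem spitzerTerm_eq_zero_right (b : ℂ) (α β : ℝ) {k q : ℕ} (j p : ℕ) (h : logPow ν k q = 0) :
    spitzerTerm ν a b α β j k p q = 0 := by
  simp only [spitzerTerm, h, FiniteMeasure.toMeasure_zero, Measure.prod_zero,
    integral_zero_measure, mul_zero]

/-- Only `j ≤ p` and `k ≤ q` contribute, since the logarithmic series has no constant term. The
indices `j = 0` and `k = 0` drop out because `p` and `q` are nonzero. -/
theorem hasSum_spitzerTerm_index (ν : FiniteMeasure (ℝ × ℝ)) (a b : ℂ) (α β : ℝ) {p q : ℕ}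
    (hp : p ≠ 0) (hq : q ≠ 0) :
    HasSum (fun jk : ℕ+ × ℕ+ => spitzerTerm ν a b α β jk.1 jk.2 p q)
      (a ^ p * b ^ q *
        ∫ e, testFun α β e ∂((walkLaw ν p : Measure (ℝ × ℝ)).prod (walkLaw ν q))) := by
  have h0 := hasSum_sum_of_ne_finset_zero (L := .unconditional _)
    (f := fun jk : ℕ × ℕ => spitzerTerm ν a b α β jk.1 jk.2 p q)
    (s := Finset.range (p + 1) ×ˢ Finset.range (q + 1)) (fun jk hjk => by
      rw [Finset.mem_product, Finset.mem_range, Finset.mem_range, not_and_or] at hjk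
      rcases hjk with h | h
      · exact spitzerTerm_eq_zero_left _ _ _ _ _ (logPow_of_lt (by lia))
      · exact spitzerTerm_eq_zero_right _ _ _ _ _ (logPow_of_lt (by lia)))
  have h1 := hasSum_pnat_prod h0
    (fun k => spitzerTerm_eq_zero_left _ _ _ _ _ (logPow_zero_left hp))
    (fun j => spitzerTerm_eq_zero_right _ _ _ _ _ (logPow_zero_left hq))
  rw [integral_walkLaw_prod ν (measurable_testFun α β) (norm_testFun_le α β), Finset.mul_sum]
  convert h1 using 1
  refine Finset.sum_congr rfl fun jk _ => ?_
  rw [spitzerTerm]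
  ring

end Walk

end WalkMax

/-! ### Assembly of the main theorem -/

theorem theorem1p12 {Ω : Type*} [MeasurableSpace Ω] (μ : Measure Ω) [IsProbabilityMeasure μ]
    (φ : 𝓢(ℝ, ℝ)) (hφ : ∀ x, 0 ≤ φ x)
    (X : ℕ → Ω → ℝ)
    (hlaw : ∀ i, HasLaw (X i) (volume.withDensity fun x => ENNReal.ofReal (φ x)) μ)
    (hindep : iIndepFun X μ)
    (a b : ℂ) (ha : ‖a‖ < 1) (hb : ‖b‖ < 1) (α β : ℝ) :
    -- the series on the left-hand side converges absolutely
    (Summable fun pq : ℕ+ × ℕ+ =>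
      a ^ (pq.1 : ℕ) * b ^ (pq.2 : ℕ) *
        ∫ ω, Complex.exp (Complex.I * ((α * WalkMax.position X pq.1 ω
          + β * WalkMax.runningMax X (pq.1 + pq.2) ω : ℝ) : ℂ)) ∂μ) ∧
    -- the series defining the `j`-maps converge at the values of `φ̂`
    (∀ (j : ℕ+) (η : Fin j → ℝ),
      (Summable fun m : ℕ => WalkMax.taylorCoeff (WalkMax.geom a) m *
        WalkMax.phiMonomial j m (fun i => WalkMax.hat φ (η i))) ∧
      (Summable fun m : ℕ => WalkMax.taylorCoeff (WalkMax.geom b) m *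
        WalkMax.phiMonomial j m (fun i => WalkMax.hat φ (η i)))) ∧
    -- all integrals on the right-hand side converge absolutely
    (∀ j k : ℕ+, Integrable (WalkMax.symbol φ a b j k) ∧
      Integrable (WalkMax.integrand φ a b α β j k)) ∧
    -- the series on the right-hand side converges absolutely to the left-hand side
    HasSum
      (fun jk : ℕ+ × ℕ+ =>
        (1 / ((jk.1 : ℕ).factorial : ℂ)) * (1 / ((jk.2 : ℕ).factorial : ℂ)) *
          ∫ w, WalkMax.integrand φ a b α β jk.1 jk.2 w)
      (∑' pq : ℕ+ × ℕ+,
        a ^ (pq.1 : ℕ) * b ^ (pq.2 : ℕ) *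
          ∫ ω, Complex.exp (Complex.I * ((α * WalkMax.position X pq.1 ω
            + β * WalkMax.runningMax X (pq.1 + pq.2) ω : ℝ) : ℂ)) ∂μ) := by
  have hX : ∀ i, AEMeasurable (X i) μ := fun i => (hlaw i).aemeasurable
  have hmap (i : ℕ) : μ.map (fun ω => (X i ω, X i ω)) =
      (volume.withDensity fun x => ENNReal.ofReal (φ x)).map fun x => (x, x) := by
    rw [← (hlaw i).map_eq, AEMeasurable.map_map_of_aemeasurable (by fun_prop) (hX i)]
    rfl
  have hprob : IsProbabilityMeasure (volume.withDensity fun x => ENNReal.ofReal (φ x)) :=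
    (hlaw 0).isProbabilityMeasure_iff.1 inferInstance
  have h1 : ∫ x, φ x = 1 := by
    rw [integral_eq_lintegral_of_nonneg_ae (Filter.Eventually.of_forall hφ)
      φ.continuous.aestronglyMeasurable]
    have := hprob.measure_univ
    rw [withDensity_apply _ MeasurableSet.univ, Measure.restrict_univ] at this
    rw [this, ENNReal.toReal_one]
  have hprob' : IsProbabilityMeasure
      ((volume.withDensity fun x => ENNReal.ofReal (φ x)).map fun x : ℝ => (x, x)) :=
    Measure.isProbabilityMeasure_map (by fun_prop)
  obtain ⟨ν, hν⟩ : ∃ ν : FiniteMeasure (ℝ × ℝ), (ν : Measure (ℝ × ℝ)) =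
      (volume.withDensity fun x => ENNReal.ofReal (φ x)).map fun x => (x, x) :=
    ⟨⟨_, inferInstance⟩, rfl⟩
  have hmass : ν.mass = 1 := by
    rw [← ENNReal.coe_inj, FiniteMeasure.ennreal_mass, hν]
    simp
  have hwalk (p q : ℕ) := WalkMax.integral_walk_eq hX hindep
    (fun i => (hmap i).trans hν.symm) α β p q
  have ht := WalkMax.summable_spitzerTerm hφ h1 hν hmass ha hb α β
  have hcol (pq : ℕ+ × ℕ+) : HasSum
      (fun jk : ℕ+ × ℕ+ => WalkMax.spitzerTerm ν a b α β jk.1 jk.2 pq.1 pq.2)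
      (a ^ (pq.1 : ℕ) * b ^ (pq.2 : ℕ) *
        ∫ ω, Complex.exp (Complex.I * ((α * WalkMax.position X pq.1 ω
          + β * WalkMax.runningMax X (pq.1 + pq.2) ω : ℝ) : ℂ)) ∂μ) := by
    rw [hwalk]
    exact WalkMax.hasSum_spitzerTerm_index ν a b α β pq.1.ne_zero pq.2.ne_zero
  have hrow (jk : ℕ+ × ℕ+) : HasSum
      (fun pq : ℕ+ × ℕ+ => WalkMax.spitzerTerm ν a b α β jk.1 jk.2 pq.1 pq.2)
      ((1 / ((jk.1 : ℕ).factorial : ℂ)) * (1 / ((jk.2 : ℕ).factorial : ℂ)) *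
        ∫ w, WalkMax.integrand φ a b α β jk.1 jk.2 w) :=
    WalkMax.hasSum_spitzerTerm_time hφ h1 hν hmass ha hb α β jk.1.pos jk.2.pos
  -- Summing the quadruple family over `(j, k)` first gives the left-hand series; the other order,
  -- used at the end, gives the right-hand one.
  have hL := ((Equiv.prodComm _ _).hasSum_iff.2 ht.hasSum).prod_fiberwise hcol
  refine ⟨hL.summable, fun j η => ⟨?_, ?_⟩, fun j k => ⟨?_, ?_⟩, ?_⟩
  · exact (WalkMax.hasSum_Phi_geom a j.pos fun i =>
      (WalkMax.norm_mul_hat_le hφ h1 a (η i)).trans_lt ha).summable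
  · exact (WalkMax.hasSum_Phi_geom b j.pos fun i =>
      (WalkMax.norm_mul_hat_le hφ h1 b (η i)).trans_lt hb).summable
  · exact WalkMax.integrable_symbol hφ h1 ha hb j.pos k.pos
  · exact WalkMax.integrable_integrand hφ h1 ha hb α β j.pos k.pos
  · rw [hL.tsum_eq]
    exact ht.hasSum.prod_fiberwise hrow
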